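/- **Setting.** Let $R$ be a commutative ring with commuting derivations $\partial_1,\dots,\partial_m$ and an action $g\mapsto\hat g$ of a discrete group $\Gamma$ by ring automorphisms commuting with the $\partial_l$ (a differential-difference ring; for trivial $\Gamma$, a differential ring). A *constant* is an element of $R$ killed by all $\partial_l$ and fixed by all $\hat g$. An *extension* of $R$ is a differential-difference ring containing $R$. In any such ring, $a\sim b$ means $a-b\in\sum_l\operatorname{Im}\partial_l+\sum_{g\in\Gamma}\operatorname{Im}(\hat g-1)$. *Operator* means a matrix of finite sums $\sum a_{g,\sigma}\,\hat g\,\partial^\sigma$ ($a_{g,\sigma}\in R$), acting on vectors over every extension; $^\dagger$ denotes the formal adjoint, $(a\,\hat g\,\partial^\sigma)^\dagger=(-\partial)^\sigma\hat g^{-1}a$. Let $\langle u,x\rangle=\sum_i u_ix_i$. Let $\mathcal G=R^N$ be a differential-difference Lie algebra: its bracket $[\,,]$ is a bilinear differential-difference operator with coefficients in $R$ which is skew and satisfies the Jacobi identity over every extension of $R$. Put $\mathcal G^*=R^N$, with coadjoint action $x.u=-(\operatorname{ad}_x)^\dagger(u)$, so $\langle x.u,y\rangle\sim-\langle u,[x,y]\rangle$.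 Let $\mathcal O:\mathcal G^*\to\mathcal G$ be a skew-symmetric $\mathcal O$-operator, i.e. an operator such that over every extension $$\langle u,\mathcal O(v)\rangle\sim-\langle v,\mathcal O(u)\rangle,\qquad \mathcal O\big(\mathcal O(u).v-\mathcal O(v).u\big)=[\mathcal O(u),\mathcal O(v)].$$ Let $C_u=R[u_i^{(g|\sigma)}]$ ($1\le i\le N$, $g\in\Gamma$, $\sigma\in\mathbb Z_{\ge0}^m$), with the derivations and the action extended by $\partial_l u_i^{(g|\sigma)}=u_i^{(g|\sigma+1_l)}$, $\hat h u_i^{(g|\sigma)}=u_i^{(hg|\sigma)}$, and let $\delta H/\delta u_i=\sum_{g,\sigma}(\hat g\,\partial^\sigma)^\dagger\big(\partial H/\partial u_i^{(g|\sigma)}\big)$. An operator $B$ on $C_u^N$ defines $\{H,F\}=X_H(F)$, where $X_H$ is the evolution derivation of $C_u$ (killing $R$ and commuting with all $\partial_l,\hat g$) with $X_H(u)=B(\delta H/\delta u)$; thus $\{H,F\}\sim\langle B(\delta H/\delta u),\delta F/\delta u\rangle$. A bracket is *Poisson* if it is skew-symmetric and satisfies the Jacobi identity, both modulo $\sim$,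 for all elements of $C_u$. Brackets are *compatible* if all their linear combinations with constant coefficients are Poisson. Let $\{\,,\}_1$ be the linear (Lie–Poisson) bracket, $B(Y)=-Y.u$, and $\{\,,\}_2$ the quadratic bracket, $B(Y)=\mathcal O(Y.u).u$. **Theorem.** 1. For all $H,F\in C_u$, $$\{H,F\}_2\sim\Big\langle\tfrac{\delta H}{\delta u}.u,\ \mathcal O\big(\tfrac{\delta F}{\delta u}.u\big)\Big\rangle\sim-\Big\langle\tfrac{\delta F}{\delta u}.u,\ \mathcal O\big(\tfrac{\delta H}{\delta u}.u\big)\Big\rangle\sim\Big\langle\mathcal O\big(\tfrac{\delta H}{\delta u}.u\big).u,\ \tfrac{\delta F}{\delta u}\Big\rangle,$$ and $\{\,,\}_2$ is a Poisson bracket. 2. $\{\,,\}_1$ and $\{\,,\}_2$ are compatible. 3. If $\mathcal O$ is invertible, with an operator $\mathcal O^{-1}$ as inverse, then for each constant $\varepsilon$ the bracket $\{\,,\}_0$ with $B=\varepsilon\mathcal O^{-1}$ and the brackets $\{\,,\}_1$, $\{\,,\}_2$ are compatible (all three together). 4. (Naturality.) Let $\mathcal H=R^M$ be another differential-difference Lie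 algebra and let the operator $\varphi:\mathcal G\to\mathcal H$ be a Lie algebra homomorphism over every extension of $R$. Then $\mathcal O_{\mathcal H}=\varphi\,\mathcal O\,\varphi^\dagger:\mathcal H^*\to\mathcal H$ is a skew-symmetric $\mathcal O$-operator, and the homomorphism $\Phi:C_u\to C_q=R[q_j^{(g|\sigma)}]$ over $R$, commuting with all $\partial_l$, $\hat g$, with $\Phi(u)=\varphi^\dagger(q)$, satisfies $\Phi(\{H,F\}_2)=\{\Phi(H),\Phi(F)\}_2$ for all $H,F\in C_u$, where the right-hand bracket is the quadratic bracket of $\mathcal O_{\mathcal H}$. 5. (Infinitesimal Hamiltonian action.) For $X\in\mathcal G$ let $X^\wedge$ be the evolution derivation of $C_u$ with $X^\wedge(u)=X.u$. Then $[X^\wedge,Y^\wedge]=-[X,Y]^\wedge$. For each $H\in C_u$ there is a unique $H^\sim\in C_u^N$ with $\langle H^\sim,X\rangle\sim X^\wedge(H)$ for all $X$ with entries in any extension $S$ of $R$ (the relation being taken in $S[u_i^{(g|\sigma)}]$). For all $H,F\in C_u$ and $X\in\mathcal G$, $$X^\wedge(\{H,F\}_2)-\{X^\wedge(H),F\}_2-\{H,X^\wedge(F)\}_2\sim\langle[H^\sim,F^\sim],X\rangle,$$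 where $[p,q]=\mathcal O(p).q-\mathcal O(q).p$. -/

import Mathlib

universe u v w

namespace DiffDiff

noncomputable section

/-- A differential-difference ring: a commutative ring `A` with commuting derivations
`∂₁, …, ∂ₘ` and an action of the discrete group `Γ` by ring automorphisms which commute with
the derivations.  (For trivial `Γ` this is a differential ring.) -/
class DDRing (m : ℕ) (Γ : Type*) [Group Γ] (A : Type*) [CommRing A] where
  d : Fin m → A →+ A
  shift : Γ →* RingAut A
  d_mul : ∀ l a b, d l (a * b) = a * d l b + d l a * b
  d_comm : ∀ i j a, d i (d j a) = d j (d i a)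
  shift_d : ∀ g i a, shift g (d i a) = d i (shift g a)

/-- The index `(g, σ)` of the elementary operator `ĝ ∂^σ`. -/
abbrev JetIndex (m : ℕ) (Γ : Type*) := Γ × (Fin m → ℕ)

section Basic

variable (m : ℕ) (Γ : Type*) [Group Γ]

/-- The partial derivative `∂^σ = ∂₁^{σ₁} ⋯ ∂ₘ^{σₘ}`. -/
def dpow {A : Type*} [CommRing A] [DDRing m Γ A] (σ : Fin m → ℕ) (a : A) : A :=
  (List.finRange m).foldr (fun l b => (DDRing.d Γ l : A →+ A)^[σ l] b) a

/-- The elementary operator `ĝ ∂^σ`. -/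
def jet {A : Type*} [CommRing A] [DDRing m Γ A] (p : JetIndex m Γ) (a : A) : A :=
  (DDRing.shift m p.1 : RingAut A) (dpow m Γ p.2 a)

/-- The formal adjoint `(ĝ ∂^σ)† = (-∂)^σ ĝ⁻¹`. -/
def jetAdj {A : Type*} [CommRing A] [DDRing m Γ A] (p : JetIndex m Γ) (a : A) : A :=
  (-1) ^ (∑ l, p.2 l) * dpow m Γ p.2 ((DDRing.shift m p.1⁻¹ : RingAut A) a)

/-- `a ∼ b` iff `a - b ∈ ∑ₗ Im ∂ₗ + ∑_g Im (ĝ - ê)`. -/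
def Sim {A : Type*} [CommRing A] [DDRing m Γ A] (a b : A) : Prop :=
  a - b ∈ AddSubgroup.closure
    ({x : A | ∃ (l : Fin m) (y : A), x = (DDRing.d Γ l : A →+ A) y} ∪
     {x : A | ∃ (g : Γ) (y : A), x = (DDRing.shift m g : RingAut A) y - y})

/-- Constants: elements killed by all derivations and fixed by all shifts. -/
def IsConst {A : Type*} [CommRing A] [DDRing m Γ A] (a : A) : Prop :=
  (∀ l : Fin m, (DDRing.d Γ l : A →+ A) a = 0) ∧
    ∀ g : Γ, (DDRing.shift m g : RingAut A) a = a

/-- `S` is a differential-difference extension of `R`. -/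
structure IsDDExt (R : Type*) [CommRing R] [DDRing m Γ R] (S : Type*) [CommRing S]
    [DDRing m Γ S] [Algebra R S] : Prop where
  injective : Function.Injective (algebraMap R S)
  map_d : ∀ (l : Fin m) (a : R),
    algebraMap R S ((DDRing.d Γ l : R →+ R) a) =
      (DDRing.d Γ l : S →+ S) (algebraMap R S a)
  map_shift : ∀ (g : Γ) (a : R),
    algebraMap R S ((DDRing.shift m g : RingAut R) a) =
      (DDRing.shift m g : RingAut S) (algebraMap R S a)

end Basic

/-! ### The ring `C_u = R[u_i^{(g|σ)}]` -/

section JetRing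

/-- The additive map of a polynomial ring which extends the derivation `δ` of the coefficients,
obeys the Leibniz rule and sends the variable `X v` to `f v`: the `ε`-part of the ring
homomorphism to the dual numbers with `a ↦ a + ε δ a` and `X v ↦ X v + ε f v`. -/
def extendDualHom {A ι : Type*} [CommRing A] (δ : A →+ A)
    (hδ : ∀ a b, δ (a * b) = a * δ b + δ a * b) (f : ι → MvPolynomial ι A) :
    MvPolynomial ι A →+* DualNumber (MvPolynomial ι A) :=
  MvPolynomial.eval₂Hom
    { toFun := fun a => TrivSqZeroExt.inl (MvPolynomial.C a) +
        TrivSqZeroExt.inr (MvPolynomial.C (δ a))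
      map_one' := by
        have h : δ 1 = 0 := by simpa using hδ 1 1
        ext <;> simp [h]
      map_zero' := by ext <;> simp
      map_mul' := fun a b => by
        ext
        · simp
        · simp [hδ, mul_comm]
      map_add' := fun a b => by ext <;> simp }
    fun v => TrivSqZeroExt.inl (MvPolynomial.X v) + TrivSqZeroExt.inr (f v)

theorem extendDualHom_fst {A ι : Type*} [CommRing A] (δ : A →+ A)
    (hδ : ∀ a b, δ (a * b) = a * δ b + δ a * b) (f : ι → MvPolynomial ι A)
    (p : MvPolynomial ι A) : (extendDualHom δ hδ f p).fst = p := by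
  induction p using MvPolynomial.induction_on with
  | C a => simp [extendDualHom]
  | add p q hp hq => simp [hp, hq]
  | mul_X p v hp =>
    rw [map_mul, TrivSqZeroExt.fst_mul, hp]
    simp [extendDualHom]

/-- The extension of a derivation of the coefficients to a polynomial ring, with prescribed values
on the variables. -/
def extendD {A ι : Type*} [CommRing A] (δ : A →+ A)
    (hδ : ∀ a b, δ (a * b) = a * δ b + δ a * b) (f : ι → MvPolynomial ι A) :
    MvPolynomial ι A →+ MvPolynomial ι A where
  toFun p := (extendDualHom δ hδ f p).snd
  map_zero' := by simp
  map_add' p q := by simp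

theorem extendD_mul {A ι : Type*} [CommRing A] (δ : A →+ A)
    (hδ : ∀ a b, δ (a * b) = a * δ b + δ a * b) (f : ι → MvPolynomial ι A)
    (p q : MvPolynomial ι A) :
    extendD δ hδ f (p * q) = p * extendD δ hδ f q + extendD δ hδ f p * q := by
  simp [extendD, extendDualHom_fst, mul_comm]

@[simp] theorem extendD_C {A ι : Type*} [CommRing A] (δ : A →+ A)
    (hδ : ∀ a b, δ (a * b) = a * δ b + δ a * b) (f : ι → MvPolynomial ι A) (a : A) :
    extendD δ hδ f (MvPolynomial.C a) = MvPolynomial.C (δ a) := by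
  simp [extendD, extendDualHom]

@[simp] theorem extendD_X {A ι : Type*} [CommRing A] (δ : A →+ A)
    (hδ : ∀ a b, δ (a * b) = a * δ b + δ a * b) (f : ι → MvPolynomial ι A) (v : ι) :
    extendD δ hδ f (MvPolynomial.X v) = f v := by
  simp [extendD, extendDualHom]

variable (m : ℕ) (Γ : Type*) [Group Γ]

/-- `(i, g, σ)` stands for the variable `u_i^{(g|σ)}`. -/
abbrev JetVar (N : ℕ) := Fin N × JetIndex m Γ

/-- The ring `R[u_i^{(g|σ)}]` of functions on `𝒢* = R^N`. -/
abbrev JetRing (N : ℕ) (A : Type*) [CommRing A] := MvPolynomial (JetVar m Γ N) A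

/-- The automorphism `ĥ` of the jet ring: it extends `ĥ` on the coefficients and sends
`u_i^{(g|σ)}` to `u_i^{(hg|σ)}`. -/
def jetShiftHom (N : ℕ) (A : Type*) [CommRing A] [DDRing m Γ A] (h : Γ) :
    JetRing m Γ N A →+* JetRing m Γ N A :=
  MvPolynomial.eval₂Hom
    (MvPolynomial.C.comp ((DDRing.shift m h : RingAut A) : A →+* A))
    (fun v => MvPolynomial.X (v.1, h * v.2.1, v.2.2))

@[simp] theorem jetShiftHom_C (N : ℕ) (A : Type*) [CommRing A] [DDRing m Γ A] (h : Γ) (a : A) :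
    jetShiftHom m Γ N A h (MvPolynomial.C a) =
      MvPolynomial.C ((DDRing.shift m h : RingAut A) a) := by
  simp [jetShiftHom]

@[simp] theorem jetShiftHom_X (N : ℕ) (A : Type*) [CommRing A] [DDRing m Γ A] (h : Γ)
    (v : JetVar m Γ N) :
    jetShiftHom m Γ N A h (MvPolynomial.X v) = MvPolynomial.X (v.1, h * v.2.1, v.2.2) := by
  simp [jetShiftHom]

theorem jetShiftHom_one (N : ℕ) (A : Type*) [CommRing A] [DDRing m Γ A] :
    jetShiftHom m Γ N A 1 = RingHom.id _ := by
  apply MvPolynomial.ringHom_ext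
  · intro a; simp
  · rintro ⟨i, g, σ⟩; simp

theorem jetShiftHom_mul (N : ℕ) (A : Type*) [CommRing A] [DDRing m Γ A] (g h : Γ) :
    jetShiftHom m Γ N A (g * h) = (jetShiftHom m Γ N A g).comp (jetShiftHom m Γ N A h) := by
  apply MvPolynomial.ringHom_ext
  · intro a; simp
  · rintro ⟨i, g, σ⟩; simp [mul_assoc]

/-- The differential-difference structure of the jet ring: it extends the one of the
coefficients, with `∂ₗ u_i^{(g|σ)} = u_i^{(g|σ+1ₗ)}` and `ĥ u_i^{(g|σ)} = u_i^{(hg|σ)}`. -/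
instance instDDRingJetRing (N : ℕ) (A : Type*) [CommRing A] [DDRing m Γ A] :
    DDRing m Γ (JetRing m Γ N A) where
  d l := extendD (DDRing.d Γ l) (DDRing.d_mul l)
    (fun v => MvPolynomial.X (v.1, v.2.1, v.2.2 + Pi.single l 1))
  shift :=
    { toFun := fun g => RingEquiv.ofRingHom (jetShiftHom m Γ N A g) (jetShiftHom m Γ N A g⁻¹)
        (by rw [← jetShiftHom_mul, mul_inv_cancel, jetShiftHom_one])
        (by rw [← jetShiftHom_mul, inv_mul_cancel, jetShiftHom_one])
      map_one' := by
        ext p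
        simp [jetShiftHom_one]
      map_mul' := fun g h => by
        ext p
        simp [jetShiftHom_mul] }
  d_mul l a b := extendD_mul _ _ _ a b
  d_comm i j a := by
    induction a using MvPolynomial.induction_on with
    | C a => simp [DDRing.d_comm i j]
    | add p q hp hq => simp [hp, hq]
    | mul_X p v hp =>
      simp only [extendD_mul, extendD_X, map_add, hp]
      rw [add_right_comm v.2.2 (Pi.single i 1)]
      ring
  shift_d g i a := by
    simp only [MonoidHom.coe_mk, OneHom.coe_mk, RingEquiv.ofRingHom_apply]
    induction a using MvPolynomial.induction_on with
    | C a => simp [DDRing.shift_d g i]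
    | add p q hp hq => simp [hp, hq]
    | mul_X p v hp => simp [extendD_mul, hp]

end JetRing

/-! ### Functional derivatives and evolution derivations -/

section Variational

variable {m : ℕ} {Γ : Type*} [Group Γ] {N : ℕ} {A : Type*} [CommRing A] [DDRing m Γ A]

/-- The generic point `u = (u_1, …, u_N)` of `𝒢*`. -/
def gen (m : ℕ) (Γ : Type*) [Group Γ] (N : ℕ) (A : Type*) [CommRing A] :
    Fin N → JetRing m Γ N A :=
  fun i => MvPolynomial.X (i, 1, 0)

/-- The functional derivative `δH/δu_i = ∑_{g,σ} (ĝ∂^σ)† (∂H/∂u_i^{(g|σ)})`. -/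
def vder (H : JetRing m Γ N A) : Fin N → JetRing m Γ N A := fun i =>
  ∑ v ∈ H.vars.filter (fun v => v.1 = i), jetAdj m Γ v.2 (MvPolynomial.pderiv v H)

/-- The evolution derivation of the jet ring with `u_i ↦ w_i`: it kills the coefficients and sends
`u_i^{(g|σ)}` to `ĝ∂^σ w_i`. -/
def evol (W : Fin N → JetRing m Γ N A) :
    Derivation A (JetRing m Γ N A) (JetRing m Γ N A) :=
  MvPolynomial.mkDerivation A fun v => jet m Γ v.2 (W v.1)

/-- The bracket `{H, F} = X_H(F)` of an operator `B`; here `X_H` is the evolution derivation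
`u ↦ B(δH/δu)`. -/
def bracketOf (B : (Fin N → JetRing m Γ N A) → (Fin N → JetRing m Γ N A))
    (H F : JetRing m Γ N A) : JetRing m Γ N A :=
  evol (B (vder H)) F

/-- A Poisson bracket: skew-symmetry and the Jacobi identity, both modulo `∼`. -/
structure IsPoisson (br : JetRing m Γ N A → JetRing m Γ N A → JetRing m Γ N A) : Prop where
  skew : ∀ H F, Sim m Γ (br H F) (-br F H)
  jacobi : ∀ H F G, Sim m Γ (br (br H F) G + br (br F G) H + br (br G H) F) 0

/-- Compatibility of brackets: every linear combination with constant coefficients is a Poisson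
bracket. -/
def Compatible {k : ℕ} (br : Fin k → JetRing m Γ N A → JetRing m Γ N A → JetRing m Γ N A) :
    Prop :=
  ∀ a : Fin k → A, (∀ j, IsConst m Γ (a j)) →
    IsPoisson fun H F => ∑ j, MvPolynomial.C (a j) * br j H F

end Variational

/-! ### Differential-difference operators and Lie algebras -/

section Operators

/-- The pairing `⟨u, x⟩ = ∑ u_i x_i`. -/
def pair {N : ℕ} {T : Type*} [CommRing T] (U x : Fin N → T) : T := ∑ i, U i * x i

/-- A matrix differential-difference operator `R^N → R^M`: the entry `(k, i)` is the finite sum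
`∑ a_{g,σ} ĝ∂^σ` with coefficients in `R`. -/
abbrev DDOp (m : ℕ) (Γ : Type*) (R : Type*) [CommRing R] (M N : ℕ) :=
  Fin M → Fin N → (JetIndex m Γ →₀ R)

/-- Coefficients of a bilinear differential-difference operator `R^N × R^N → R^N`. -/
abbrev DDBilin (m : ℕ) (Γ : Type*) (R : Type*) [CommRing R] (N : ℕ) :=
  Fin N → Fin N → Fin N → (JetIndex m Γ × JetIndex m Γ →₀ R)

variable {m : ℕ} {Γ : Type*} [Group Γ] {R : Type*} [CommRing R] {M N : ℕ}
  {T : Type*} [CommRing T] [Algebra R T] [DDRing m Γ T]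

/-- The action of an operator on vectors over an extension `T` of `R`. -/
def DDOp.app (P : DDOp m Γ R M N) (x : Fin N → T) : Fin M → T := fun k =>
  ∑ i, (P k i).sum fun p a => algebraMap R T a * jet m Γ p (x i)

/-- The action of the adjoint operator `P†`. -/
def DDOp.adj (P : DDOp m Γ R M N) (y : Fin M → T) : Fin N → T := fun i =>
  ∑ k, (P k i).sum fun p a => jetAdj m Γ p (algebraMap R T a * y k)

/-- The values of a bilinear operator:
`[x, y]_k = ∑ c_{k,i,j;p,q} (p x_i) (q y_j)`, with `p`, `q` of the form `ĝ∂^σ`. -/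
def DDBilin.app (c : DDBilin m Γ R N) (x y : Fin N → T) : Fin N → T := fun k =>
  ∑ i, ∑ j, (c k i j).sum fun pq a =>
    algebraMap R T a * jet m Γ pq.1 (x i) * jet m Γ pq.2 (y j)

/-- `x.u = -(ad x)† u`, i.e. `⟨x.u, y⟩ ∼ -⟨u, [x, y]⟩` for all `y`. -/
def DDBilin.coad (c : DDBilin m Γ R N) (x U : Fin N → T) : Fin N → T := fun j =>
  -∑ k, ∑ i, (c k i j).sum fun pq a =>
    jetAdj m Γ pq.2 (algebraMap R T a * jet m Γ pq.1 (x i) * U k)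

end Operators

/-- A differential-difference Lie algebra `𝒢 = R^N`: a bilinear differential-difference operator
which is skew and satisfies the Jacobi identity over all extensions of `R`. -/
structure DDLie (m : ℕ) (Γ : Type v) [Group Γ] (R : Type u) [CommRing R] [DDRing m Γ R]
    (N : ℕ) where
  c : DDBilin m Γ R N
  skew : ∀ (S : Type (max u v)) [CommRing S] [Algebra R S] [DDRing m Γ S], IsDDExt m Γ R S →
    ∀ x y : Fin N → S, c.app x y = -c.app y x
  jacobi : ∀ (S : Type (max u v)) [CommRing S] [Algebra R S] [DDRing m Γ S], IsDDExt m Γ R S →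
    ∀ x y z : Fin N → S,
      c.app (c.app x y) z + c.app (c.app y z) x + c.app (c.app z x) y = 0

section LieNotions

variable {m : ℕ} {Γ : Type v} [Group Γ] {R : Type u} [CommRing R] [DDRing m Γ R] {N M : ℕ}

/-- The commutator `[x, y]` of `𝒢`, over an extension `T`. -/
def DDLie.brac (L : DDLie m Γ R N) {T : Type w} [CommRing T] [Algebra R T] [DDRing m Γ T]
    (x y : Fin N → T) : Fin N → T :=
  L.c.app x y

/-- The coadjoint action `x.u`, over an extension `T`. -/
def DDLie.coad (L : DDLie m Γ R N) {T : Type w} [CommRing T] [Algebra R T] [DDRing m Γ T]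
    (x U : Fin N → T) : Fin N → T :=
  L.c.coad x U

/-- The commutator `[u, v] = O(u).v - O(v).u` on `𝒢*` defined by `O : 𝒢* → 𝒢`. -/
def DDLie.dualBrac (L : DDLie m Γ R N) (O : DDOp m Γ R N N)
    {T : Type w} [CommRing T] [Algebra R T] [DDRing m Γ T] (U V : Fin N → T) : Fin N → T :=
  L.coad (O.app U) V - L.coad (O.app V) U

/-- Skew-symmetric `O`-operators `O : 𝒢* → 𝒢`. -/
structure IsOOperator (L : DDLie.{u, v} m Γ R N) (O : DDOp m Γ R N N) : Prop where
  skew : ∀ (S : Type (max u v)) [CommRing S] [Algebra R S] [DDRing m Γ S], IsDDExt m Γ R S →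
    ∀ U V : Fin N → S, Sim m Γ (pair U (O.app V)) (-pair V (O.app U))
  hom : ∀ (S : Type (max u v)) [CommRing S] [Algebra R S] [DDRing m Γ S], IsDDExt m Γ R S →
    ∀ U V : Fin N → S, O.app (L.dualBrac O U V) = L.brac (O.app U) (O.app V)

/-- The operators `O` and `P` are inverse to each other. -/
structure IsInverseOp (O P : DDOp m Γ R N N) : Prop where
  left_inv : ∀ (S : Type (max u v)) [CommRing S] [Algebra R S] [DDRing m Γ S],
    IsDDExt m Γ R S → ∀ U : Fin N → S, P.app (O.app U) = U
  right_inv : ∀ (S : Type (max u v)) [CommRing S] [Algebra R S] [DDRing m Γ S],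
    IsDDExt m Γ R S → ∀ x : Fin N → S, O.app (P.app x) = x

/-- The operator `φ : 𝒢 → ℋ` is a homomorphism of Lie algebras. -/
def IsLieHom (L : DDLie.{u, v} m Γ R N) (L' : DDLie.{u, v} m Γ R M) (φ : DDOp m Γ R M N) :
    Prop :=
  ∀ (S : Type (max u v)) [CommRing S] [Algebra R S] [DDRing m Γ S], IsDDExt m Γ R S →
    ∀ x y : Fin N → S, φ.app (L.brac x y) = L'.brac (φ.app x) (φ.app y)

/-- The homomorphism `Φ : C_u → C_q` with `Φ(u) = φ†(q)` induced by `φ : 𝒢 → ℋ`; it sends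
`u_i^{(g|σ)}` to `ĝ∂^σ (φ†(q))_i`. -/
def dualMap (φ : DDOp m Γ R M N) : JetRing m Γ N R →ₐ[R] JetRing m Γ M R :=
  MvPolynomial.aeval fun v => jet m Γ v.2 (φ.adj (gen m Γ M R) v.1)

/-- The constant-coefficient bracket with Hamiltonian operator `b = ε P`. -/
def constBr (ε : R) (P : DDOp m Γ R N N) :
    JetRing m Γ N R → JetRing m Γ N R → JetRing m Γ N R :=
  bracketOf fun Y => fun i => MvPolynomial.C ε * P.app Y i

/-- The linear (Lie–Poisson) bracket, `B(Y) = -Y.u`. -/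
def linBr (L : DDLie m Γ R N) : JetRing m Γ N R → JetRing m Γ N R → JetRing m Γ N R :=
  bracketOf fun Y => -L.coad Y (gen m Γ N R)

/-- The quadratic bracket, `B(Y) = O(Y.u).u`. -/
def quadBr (L : DDLie m Γ R N) (O : DDOp m Γ R N N) :
    JetRing m Γ N R → JetRing m Γ N R → JetRing m Γ N R :=
  bracketOf fun Y => L.coad (O.app (L.coad Y (gen m Γ N R))) (gen m Γ N R)

/-- The evolution derivation `X^ : u ↦ X.u` for `X ∈ 𝒢` with entries in an extension `S` of `R`;
it acts on `S[u_i^{(g|σ)}]`. -/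
def DDLie.hat (L : DDLie m Γ R N) {S : Type w} [CommRing S] [Algebra R S] [DDRing m Γ S]
    (X : Fin N → S) : Derivation S (JetRing m Γ N S) (JetRing m Γ N S) :=
  evol (L.coad (fun i => MvPolynomial.C (X i)) (gen m Γ N S))

/-- The relation `⟨H~, X⟩ ∼ X^(H)` for all `X ∈ 𝒢` (over all extensions of `R`) which
defines `H~ ∈ C_u ⊗ 𝒢*`. -/
def IsTilde (L : DDLie.{u, v} m Γ R N) (H : JetRing m Γ N R) (K : Fin N → JetRing m Γ N R) :
    Prop :=
  ∀ (S : Type (max u v)) [CommRing S] [Algebra R S] [DDRing m Γ S], IsDDExt m Γ R S →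
    ∀ X : Fin N → S,
      Sim m Γ
        (pair (fun i => MvPolynomial.map (algebraMap R S) (K i)) fun i => MvPolynomial.C (X i))
        (L.hat X (MvPolynomial.map (algebraMap R S) H))

end LieNotions

end

end DiffDiff

open DiffDiff

/-!
All relations `∼` are equalities in the abelian group `A ⧸ (∑ Im ∂ₗ + ∑ Im (ĝ - 1))`, and the proof
is a calculation there with the adjunctions `⟨U, P x⟩ ∼ ⟨P† U, x⟩` and `⟨x.U, y⟩ ∼ -⟨U, [x, y]⟩`,
both instances of summation by parts (`cls_mul_jet`).

Relations `∼` turn back into equalities by nondegeneracy: if `⟨K, w⟩ ∼ ⟨J, w⟩` for the generic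
vector `w` of a jet ring over the coefficients, then `K = J` (`eq_of_cls_pair_gen`), because
`δ/δw` kills everything which is `∼ 0`.  Hence functional derivatives are determined by
`⟨W, δH/δu⟩ ∼ D_W(H)`, where `D_W` is the evolution derivation `u ↦ W` (`cls_evol`), the Jacobi
identity of `𝒢` becomes the statement that the coadjoint action is an action (`DDLie.coad_brac`),
and the second variational derivative is symmetric (`cls_pair_evol_vder_comm`).

The Poisson and compatibility claims are one claim about
`B_u(Y) = e₀ P(Y) - e₁ Y.u + e₂ O(Y.u).u` with constants `e₀, e₁, e₂`.  By the symmetry of the second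
derivative, `δ{H, F} = X_H(δF) - X_F(δH) + Q(δH, δF)` with `⟨B'_W(Y), Z⟩ ∼ ⟨W, Q(Y, Z)⟩`
(`vder_pencilBr`).  The Jacobi identity follows once `X_{{H,F}} = [X_H, X_F]`, which amounts to
`B(Q(Y, Z)) = B'_{B(Y)}(Z) - B'_{B(Z)}(Y)` (`pencil_pencilAdj`); this is an identity in `𝒢` and
`𝒢*`, and the defining identity of an `O`-operator is what it needs in the part quadratic in `e₂`.
When `O` is invertible, `P = O⁻¹` is a one-cocycle, which gives the terms with `e₀`.

For naturality, `φ†(φ(x).V) = x.φ†(V)` (`IsLieHom.adj_coad`) and the chain rule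
`δ(Φ H)/δq = φ(Φ(δH/δu))` (`vder_dualMap`) reduce the claim to the variables `u_i`.  The operator
`φ O φ†` itself is read off from its value at the generic point, which is a vector of linear forms.
For the infinitesimal action, `H^∼ = -(δH/δu).u`, and commuting `X^∧` with `D_W` gives
`δ(X^∧ H) = X^∧(δH) - [X, δH]` (`DDLie.vder_hat`).
-/

namespace DiffDiff

/-! ### Classes modulo `∼` and summation by parts -/

section Quotient

variable (m : ℕ) (Γ : Type*) [Group Γ] {A : Type*} [CommRing A] [DDRing m Γ A]

/-- The subgroup `∑ₗ Im ∂ₗ + ∑_g Im (ĝ - 1)`. -/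
def boundary (A : Type*) [CommRing A] [DDRing m Γ A] : AddSubgroup A :=
  AddSubgroup.closure
    ({x : A | ∃ (l : Fin m) (y : A), x = (DDRing.d Γ l : A →+ A) y} ∪
     {x : A | ∃ (g : Γ) (y : A), x = (DDRing.shift m g : RingAut A) y - y})

/-- The class of an element modulo `∼`. Working with classes turns every chain of relations `∼`
into a computation in an abelian group. -/
def cls : A →+ A ⧸ boundary m Γ A := QuotientAddGroup.mk' _

theorem sim_iff {a b : A} : Sim m Γ a b ↔ cls m Γ a = cls m Γ b :=
  (QuotientAddGroup.eq_iff_sub_mem (N := boundary m Γ A)).symm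

theorem cls_d (l : Fin m) (a : A) : cls m Γ ((DDRing.d Γ l : A →+ A) a) = 0 :=
  (QuotientAddGroup.eq_zero_iff _).2 (AddSubgroup.subset_closure (Or.inl ⟨l, a, rfl⟩))

theorem cls_shift (g : Γ) (a : A) : cls m Γ ((DDRing.shift m g : RingAut A) a) = cls m Γ a := by
  rw [← sub_eq_zero, ← map_sub]
  exact (QuotientAddGroup.eq_zero_iff _).2 (AddSubgroup.subset_closure (Or.inr ⟨g, a, rfl⟩))

/-- An additive map which vanishes on derivatives and is invariant under shifts respects `∼`. -/
theorem eq_of_cls_eq {B : Type*} [AddCommGroup B] (f : A →+ B)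
    (hd : ∀ (l : Fin m) (a : A), f ((DDRing.d Γ l : A →+ A) a) = 0)
    (hs : ∀ (g : Γ) (a : A), f ((DDRing.shift m g : RingAut A) a) = f a)
    {a b : A} (h : cls m Γ a = cls m Γ b) : f a = f b := by
  have h' : a - b ∈ boundary m Γ A := (sim_iff m Γ).2 h
  rw [← sub_eq_zero, ← map_sub]
  have : boundary m Γ A ≤ f.ker := by
    refine (AddSubgroup.closure_le _).2 ?_
    rintro x (⟨l, y, rfl⟩ | ⟨g, y, rfl⟩)
    · exact hd l y
    · simp [AddMonoidHom.mem_ker, hs]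
  exact this h'

end Quotient

section Jets

variable {m : ℕ} {Γ : Type*} [Group Γ] {A : Type*} [CommRing A] [DDRing m Γ A]
  {B : Type*} [CommRing B] [DDRing m Γ B]

variable (m Γ) in
/-- Additive maps of differential-difference rings which commute with all `∂ₗ` and all `ĝ`:
homomorphisms, evolution derivations and multiplications by constants are of this kind. -/
structure DDComm (f : A → B) : Prop where
  map_add : ∀ a b : A, f (a + b) = f a + f b
  map_d : ∀ (l : Fin m) (a : A), f ((DDRing.d Γ l : A →+ A) a) = (DDRing.d Γ l : B →+ B) (f a)
  map_shift : ∀ (g : Γ) (a : A),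
    f ((DDRing.shift m g : RingAut A) a) = (DDRing.shift m g : RingAut B) (f a)

theorem DDComm.cls_eq {f : A → B} (hf : DDComm m Γ f) {a b : A}
    (h : cls m Γ a = cls m Γ b) : cls m Γ (f a) = cls m Γ (f b) :=
  eq_of_cls_eq m Γ ((cls m Γ).comp (AddMonoidHom.mk' f hf.map_add))
    (fun l a => by simp [hf.map_d, cls_d]) (fun g a => by simp [hf.map_shift, cls_shift]) h

theorem DDComm.map_sum {f : A → B} (hf : DDComm m Γ f) {ι : Type*} (s : Finset ι) (F : ι → A) :
    f (∑ i ∈ s, F i) = ∑ i ∈ s, f (F i) :=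
  _root_.map_sum (AddMonoidHom.mk' f hf.map_add) F s

theorem DDComm.map_neg {f : A → B} (hf : DDComm m Γ f) (a : A) : f (-a) = -f a :=
  _root_.map_neg (AddMonoidHom.mk' f hf.map_add) a

theorem map_foldr_d (f : A → B)
    (hf : ∀ (l : Fin m) (a : A), f ((DDRing.d Γ l : A →+ A) a) = (DDRing.d Γ l : B →+ B) (f a))
    (σ : Fin m → ℕ) (s : List (Fin m)) (a : A) :
    f (s.foldr (fun l b => (DDRing.d Γ l : A →+ A)^[σ l] b) a) =
      s.foldr (fun l b => (DDRing.d Γ l : B →+ B)^[σ l] b) (f a) := by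
  induction s with
  | nil => rfl
  | cons l s ih =>
    have h : Function.Semiconj f (DDRing.d Γ l : A →+ A) (DDRing.d Γ l : B →+ B) := hf l
    simp only [List.foldr_cons]
    rw [(h.iterate_right (σ l)).eq, ih]

theorem map_dpow (f : A → B)
    (hf : ∀ (l : Fin m) (a : A), f ((DDRing.d Γ l : A →+ A) a) = (DDRing.d Γ l : B →+ B) (f a))
    (σ : Fin m → ℕ) (a : A) : f (dpow m Γ σ a) = dpow m Γ σ (f a) :=
  map_foldr_d f hf σ _ a

theorem dpow_add (σ : Fin m → ℕ) (a b : A) :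
    dpow m Γ σ (a + b) = dpow m Γ σ a + dpow m Γ σ b := by
  unfold dpow
  induction List.finRange m with
  | nil => rfl
  | cons l s ih => simp only [List.foldr_cons]; rw [ih, iterate_map_add]

theorem dpow_zero (a : A) : dpow m Γ 0 a = a := by
  unfold dpow
  induction List.finRange m with
  | nil => rfl
  | cons l s ih => simp

theorem dpow_add_single (σ : Fin m → ℕ) (l : Fin m) (a : A) :
    dpow m Γ (σ + Pi.single l 1) a = (DDRing.d Γ l : A →+ A) (dpow m Γ σ a) := by
  have key : ∀ s : List (Fin m), s.Nodup →
      s.foldr (fun k b => (DDRing.d Γ k : A →+ A)^[(σ + Pi.single l 1 : Fin m → ℕ) k] b) a =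
        if l ∈ s then (DDRing.d Γ l : A →+ A)
          (s.foldr (fun k b => (DDRing.d Γ k : A →+ A)^[σ k] b) a)
        else s.foldr (fun k b => (DDRing.d Γ k : A →+ A)^[σ k] b) a := by
    intro s hs
    induction s with
    | nil => rfl
    | cons k s ih =>
      rw [List.nodup_cons] at hs
      simp only [List.foldr_cons]
      rw [ih hs.2]
      by_cases hk : l = k
      · subst hk
        simp [hs.1, Function.iterate_succ_apply']
      · have hc : Function.Commute (DDRing.d Γ k : A →+ A) (DDRing.d Γ l : A →+ A) :=
          fun x => DDRing.d_comm k l x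
        by_cases hl : l ∈ s
        · simp [hl, Ne.symm hk, (hc.iterate_left (σ k)).eq]
        · simp [hl, hk, Ne.symm hk]
  simpa [dpow] using key _ (List.nodup_finRange m)

/-- `ĝ ∂^σ` as an additive map. -/
def jetHom (p : JetIndex m Γ) : A →+ A where
  toFun := jet m Γ p
  map_zero' := by
    have h : dpow m Γ p.2 (0 : A) = 0 := by simpa using dpow_add (Γ := Γ) p.2 (0 : A) 0
    simp [jet, h]
  map_add' a b := by simp [jet, dpow_add]

/-- `(ĝ ∂^σ)†` as an additive map. -/
def jetAdjHom (p : JetIndex m Γ) : A →+ A where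
  toFun := jetAdj m Γ p
  map_zero' := by
    have h : dpow m Γ p.2 (0 : A) = 0 := by simpa using dpow_add (Γ := Γ) p.2 (0 : A) 0
    simp [jetAdj, h]
  map_add' a b := by simp [jetAdj, dpow_add, mul_add]

@[simp] theorem jet_add (p : JetIndex m Γ) (a b : A) :
    jet m Γ p (a + b) = jet m Γ p a + jet m Γ p b := (jetHom p).map_add a b

@[simp] theorem jetAdj_add (p : JetIndex m Γ) (a b : A) :
    jetAdj m Γ p (a + b) = jetAdj m Γ p a + jetAdj m Γ p b := (jetAdjHom p).map_add a b

@[simp] theorem jet_neg (p : JetIndex m Γ) (a : A) : jet m Γ p (-a) = -jet m Γ p a :=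
  (jetHom p).map_neg a

@[simp] theorem jetAdj_neg (p : JetIndex m Γ) (a : A) : jetAdj m Γ p (-a) = -jetAdj m Γ p a :=
  (jetAdjHom p).map_neg a

@[simp] theorem jetAdj_zero (p : JetIndex m Γ) : jetAdj m Γ p (0 : A) = 0 :=
  (jetAdjHom p).map_zero

theorem jet_one_zero (a : A) : jet m Γ ((1, 0) : JetIndex m Γ) a = a := by
  simp [jet, dpow_zero]

theorem jetAdj_one_zero (a : A) : jetAdj m Γ ((1, 0) : JetIndex m Γ) a = a := by
  simp [jetAdj, dpow_zero]

theorem d_jet (l : Fin m) (p : JetIndex m Γ) (a : A) :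
    (DDRing.d Γ l : A →+ A) (jet m Γ p a) = jet m Γ (p.1, p.2 + Pi.single l 1) a := by
  simp only [jet]
  rw [dpow_add_single, DDRing.shift_d]

theorem shift_jet (h : Γ) (p : JetIndex m Γ) (a : A) :
    (DDRing.shift m h : RingAut A) (jet m Γ p a) = jet m Γ (h * p.1, p.2) a := by
  simp [jet]

theorem DDComm.map_jet {f : A → B} (hf : DDComm m Γ f) (p : JetIndex m Γ) (a : A) :
    f (jet m Γ p a) = jet m Γ p (f a) := by
  simp only [jet]
  rw [hf.map_shift, map_dpow f hf.map_d]

theorem neg_one_pow_mul_eq_zsmul {A : Type*} [CommRing A] (k : ℕ) (a : A) :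
    (-1) ^ k * a = ((-1 : ℤ) ^ k) • a := by
  simp

theorem DDComm.map_jetAdj {f : A → B} (hf : DDComm m Γ f) (p : JetIndex m Γ) (a : A) :
    f (jetAdj m Γ p a) = jetAdj m Γ p (f a) := by
  simp only [jetAdj, neg_one_pow_mul_eq_zsmul]
  have h : ∀ (k : ℤ) (a : A), f (k • a) = k • f a :=
    fun k a => map_zsmul (AddMonoidHom.mk' f hf.map_add) k a
  rw [h, map_dpow f hf.map_d, hf.map_shift]

theorem cls_mul_d (l : Fin m) (a b : A) :
    cls m Γ (a * (DDRing.d Γ l : A →+ A) b) = -cls m Γ ((DDRing.d Γ l : A →+ A) a * b) := by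
  rw [eq_neg_iff_add_eq_zero, ← map_add, ← DDRing.d_mul, cls_d]

theorem cls_mul_shift (g : Γ) (a b : A) :
    cls m Γ (a * (DDRing.shift m g : RingAut A) b) =
      cls m Γ ((DDRing.shift m g⁻¹ : RingAut A) a * b) := by
  rw [← cls_shift m Γ g ((DDRing.shift m g⁻¹ : RingAut A) a * b)]
  simp

/-- Summation and integration by parts: `a (ĝ∂^σ b) ∼ ((ĝ∂^σ)† a) b`. -/
theorem cls_mul_jet (p : JetIndex m Γ) (a b : A) :
    cls m Γ (a * jet m Γ p b) = cls m Γ (jetAdj m Γ p a * b) := by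
  have iter : ∀ (l : Fin m) (k : ℕ) (a b : A),
      cls m Γ (a * (DDRing.d Γ l : A →+ A)^[k] b) =
        ((-1 : ℤ) ^ k) • cls m Γ ((DDRing.d Γ l : A →+ A)^[k] a * b) := by
    intro l k
    induction k with
    | zero => simp
    | succ k ih =>
      intro a b
      rw [Function.iterate_succ_apply, ih, cls_mul_d, pow_succ,
        Function.iterate_succ_apply']
      simp
  have key : ∀ (s : List (Fin m)) (a b : A),
      cls m Γ (a * s.foldr (fun l b => (DDRing.d Γ l : A →+ A)^[p.2 l] b) b) =
        ((-1 : ℤ) ^ (s.map p.2).sum) • cls m Γ (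
          s.foldr (fun l b => (DDRing.d Γ l : A →+ A)^[p.2 l] b) a * b) := by
    intro s
    induction s with
    | nil => intro a b; simp
    | cons l s ih =>
      intro a b
      simp only [List.foldr_cons, List.map_cons, List.sum_cons]
      have hc : ∀ k : ℕ, (DDRing.d Γ l : A →+ A)^[k]
            (s.foldr (fun l b => (DDRing.d Γ l : A →+ A)^[p.2 l] b) a) =
          s.foldr (fun l b => (DDRing.d Γ l : A →+ A)^[p.2 l] b)
            ((DDRing.d Γ l : A →+ A)^[k] a) := fun k =>
        map_foldr_d (Γ := Γ) ((DDRing.d Γ l : A →+ A)^[k]) (fun i x => by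
          have h : Function.Commute (DDRing.d Γ l : A →+ A) (DDRing.d Γ i : A →+ A) :=
            fun x => DDRing.d_comm l i x
          exact (h.iterate_left k).eq x) p.2 s a
      rw [iter, ih, hc, pow_add, mul_smul]
  have h2 : ((List.finRange m).map p.2).sum = ∑ l, p.2 l := by
    rw [← List.ofFn_eq_map, List.sum_ofFn]
  simp only [jet, jetAdj, neg_one_pow_mul_eq_zsmul, smul_mul_assoc, map_zsmul]
  rw [cls_mul_shift]
  unfold dpow
  rw [key, h2]

end Jets

/-! ### Jet rings and variational calculus -/

section Evaluation

variable {m : ℕ} {Γ : Type*} [Group Γ] {N : ℕ} {A : Type*} [CommRing A]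
  {T : Type*} [CommRing T] [DDRing m Γ T]

open MvPolynomial

/-- The homomorphism `u_i^{(g|σ)} ↦ ĝ∂^σ U_i` of evaluation at a point `U` over `T`. -/
def evalJet [Algebra A T] (U : Fin N → T) : JetRing m Γ N A →ₐ[A] T :=
  aeval fun v => jet m Γ v.2 (U v.1)

@[simp] theorem evalJet_X [Algebra A T] (U : Fin N → T) (v : JetVar m Γ N) :
    evalJet U (X v : JetRing m Γ N A) = jet m Γ v.2 (U v.1) := by simp [evalJet]

theorem evalJet_gen [Algebra A T] (U : Fin N → T) (i : Fin N) :
    evalJet U (gen m Γ N A i) = U i := by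
  simp [gen, jet_one_zero]

theorem evalJet_comp_gen [Algebra A T] (U : Fin N → T) : evalJet U ∘ gen m Γ N A = U := by
  funext i
  exact evalJet_gen U i

theorem map_gen {S : Type*} [CommRing S] (f : A →+* S) (i : Fin N) :
    map f (gen m Γ N A i) = gen m Γ N S i := by simp [gen]

end Evaluation

section JetRingStructure

variable {m : ℕ} {Γ : Type*} [Group Γ] {N : ℕ} {A : Type*} [CommRing A] [DDRing m Γ A]
  {T : Type*} [CommRing T] [DDRing m Γ T]

open MvPolynomial

@[simp] theorem d_C (l : Fin m) (a : A) :
    (DDRing.d Γ l : JetRing m Γ N A →+ JetRing m Γ N A) (C a) =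
      C ((DDRing.d Γ l : A →+ A) a) := extendD_C _ _ _ a

@[simp] theorem d_X (l : Fin m) (v : JetVar m Γ N) :
    (DDRing.d Γ l : JetRing m Γ N A →+ JetRing m Γ N A) (X v) =
      X (v.1, v.2.1, v.2.2 + Pi.single l 1) := extendD_X _ _ _ v

@[simp] theorem shift_C (g : Γ) (a : A) :
    (DDRing.shift m g : RingAut (JetRing m Γ N A)) (C a) =
      C ((DDRing.shift m g : RingAut A) a) := jetShiftHom_C m Γ N A g a

@[simp] theorem shift_X (g : Γ) (v : JetVar m Γ N) :
    (DDRing.shift m g : RingAut (JetRing m Γ N A)) (X v) = X (v.1, g * v.2.1, v.2.2) :=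
  jetShiftHom_X m Γ N A g v

theorem ddComm_C : DDComm m Γ (C : A → JetRing m Γ N A) where
  map_add a b := C.map_add a b
  map_d l a := (d_C l a).symm
  map_shift g a := (shift_C g a).symm

theorem ddComm_constantCoeff :
    DDComm m Γ (constantCoeff : JetRing m Γ N A → A) where
  map_add a b := map_add _ a b
  map_d l a := by
    induction a using MvPolynomial.induction_on with
    | C a => simp
    | add p q hp hq => simp [hp, hq]
    | mul_X p v hp => simp [DDRing.d_mul]
  map_shift g a := by
    induction a using MvPolynomial.induction_on with
    | C a => simp
    | add p q hp hq => simp [hp, hq]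
    | mul_X p v hp => simp

theorem jet_X_one_zero (i : Fin N) (p : JetIndex m Γ) :
    jet m Γ p (X (i, 1, 0) : JetRing m Γ N A) = X (i, p) := by
  have iter : ∀ (l : Fin m) (k : ℕ) (τ : Fin m → ℕ),
      (DDRing.d Γ l : JetRing m Γ N A →+ JetRing m Γ N A)^[k] (X (i, 1, τ)) =
        X (i, 1, τ + Pi.single l k) := by
    intro l k
    induction k with
    | zero => simp
    | succ k ih =>
      intro τ
      rw [Function.iterate_succ_apply', ih, d_X]
      simp only [add_assoc, ← Pi.single_add]
  have key : ∀ s : List (Fin m),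
      s.foldr (fun l b => (DDRing.d Γ l : JetRing m Γ N A →+ JetRing m Γ N A)^[p.2 l] b)
        (X (i, 1, 0)) = X (i, 1, (s.map fun l => Pi.single l (p.2 l)).sum) := by
    intro s
    induction s with
    | nil => rfl
    | cons l s ih =>
      rw [List.foldr_cons, ih, iter, List.map_cons, List.sum_cons, add_comm]
  have h2 : ((List.finRange m).map fun l => (Pi.single l (p.2 l) : Fin m → ℕ)).sum = p.2 := by
    rw [← List.ofFn_eq_map, List.sum_ofFn, Finset.univ_sum_single]
  simp only [jet, dpow]
  rw [key, h2]
  simp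

theorem jet_gen (v : JetVar m Γ N) : jet m Γ v.2 (gen m Γ N A v.1) = X v :=
  jet_X_one_zero v.1 v.2

theorem evalJet_gen_self (H : JetRing m Γ N A) : evalJet (gen m Γ N A) H = H := by
  have h : (evalJet (gen m Γ N A) : JetRing m Γ N A →ₐ[A] JetRing m Γ N A) = AlgHom.id A _ := by
    ext v
    simp [jet_gen]
  rw [h]; rfl

theorem ddComm_evalJet [Algebra A T] (hAT : DDComm m Γ (algebraMap A T)) (U : Fin N → T) :
    DDComm m Γ (evalJet U : JetRing m Γ N A → T) where
  map_add a b := map_add _ a b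
  map_d l a := by
    induction a using MvPolynomial.induction_on with
    | C a => simp [← algebraMap_eq, hAT.map_d]
    | add p q hp hq => simp [hp, hq]
    | mul_X p v hp => simp [DDRing.d_mul, hp, d_jet]
  map_shift g a := by
    induction a using MvPolynomial.induction_on with
    | C a => simp [← algebraMap_eq, hAT.map_shift]
    | add p q hp hq => simp [hp, hq]
    | mul_X p v hp => simp [hp, shift_jet]

theorem ddComm_map {S : Type*} [CommRing S] [DDRing m Γ S] (f : A →+* S) (hf : DDComm m Γ f) :
    DDComm m Γ (map f : JetRing m Γ N A → JetRing m Γ N S) where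
  map_add a b := map_add _ a b
  map_d l a := by
    induction a using MvPolynomial.induction_on with
    | C a => simp [hf.map_d]
    | add p q hp hq => simp [hp, hq]
    | mul_X p v hp => simp [DDRing.d_mul, hp]
  map_shift g a := by
    induction a using MvPolynomial.induction_on with
    | C a => simp [hf.map_shift]
    | add p q hp hq => simp [hp, hq]
    | mul_X p v hp => simp [hp]

end JetRingStructure

section VariationalCalculus

variable {m : ℕ} {Γ : Type*} [Group Γ] {N : ℕ} {A : Type*} [CommRing A] [DDRing m Γ A]
  {T : Type*} [CommRing T] [DDRing m Γ T]

open MvPolynomial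

theorem vder_eq_sum (H : JetRing m Γ N A) (i : Fin N) {s : Finset (JetVar m Γ N)}
    (hs : H.vars ⊆ s) :
    vder H i = ∑ v ∈ s.filter (fun v => v.1 = i), jetAdj m Γ v.2 (pderiv v H) := by
  unfold vder
  refine Finset.sum_subset (Finset.filter_subset_filter _ hs) fun v hv hv' => ?_
  have : v ∉ H.vars := by
    intro h
    simp_all
  rw [pderiv_eq_zero_of_notMem_vars this, jetAdj_zero]

theorem vder_add (H F : JetRing m Γ N A) : vder (H + F) = vder H + vder F := by
  classical
  funext i
  rw [Pi.add_apply, vder_eq_sum _ i (vars_add_subset H F),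
    vder_eq_sum H i (Finset.subset_union_left (s₂ := F.vars)),
    vder_eq_sum F i (Finset.subset_union_right (s₁ := H.vars)), ← Finset.sum_add_distrib]
  simp

theorem vder_map {S : Type*} [CommRing S] [DDRing m Γ S] (f : A →+* S) (hf : DDComm m Γ f)
    (H : JetRing m Γ N A) : vder (map f H) = map f ∘ vder H := by
  classical
  funext i
  rw [Function.comp_apply, vder_eq_sum (map f H) i (vars_map H f), vder, map_sum]
  refine Finset.sum_congr rfl fun v _ => ?_
  rw [(ddComm_map f hf).map_jetAdj, pderiv_map]

/-- The terms of `δH/δu` of degree zero depend only on the linear part of `H`. -/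
theorem constantCoeff_vder_mul_X (f : JetRing m Γ N A) (w : JetVar m Γ N) (i : Fin N) :
    constantCoeff (vder (f * X w) i) =
      if w.1 = i then jetAdj m Γ w.2 (constantCoeff f) else 0 := by
  classical
  have hs : (f * X w).vars ⊆ insert w f.vars := by
    refine (vars_mul _ _).trans ?_
    intro v
    rcases subsingleton_or_nontrivial A with h | h
    · simp [Subsingleton.elim f 0, Subsingleton.elim (X w : JetRing m Γ N A) 0]
    · rw [vars_X]
      simp
  rw [vder_eq_sum _ i hs, map_sum]
  have h1 : ∀ v : JetVar m Γ N,
      constantCoeff (jetAdj m Γ v.2 (pderiv v (f * X w))) =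
        if v = w then jetAdj m Γ w.2 (constantCoeff f) else 0 := by
    intro v
    rw [ddComm_constantCoeff.map_jetAdj]
    by_cases h : v = w
    · subst h
      simp
    · simp [pderiv_X, h, Ne.symm h]
  simp only [h1]
  by_cases h : w.1 = i <;> simp [h, Finset.sum_ite_eq']

/-- `δ/δu`, evaluated at `u = 0`, kills the image of `∂ₗ` and is invariant under the shifts; hence
a form linear in `u` is determined by its class modulo `∼`. -/
theorem eq_of_cls_pair_gen {a b : Fin N → A}
    (h : cls m Γ (pair (C ∘ a) (gen m Γ N A)) =
      cls m Γ (pair (C ∘ b) (gen m Γ N A))) : a = b := by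
  classical
  funext i
  let f : JetRing m Γ N A →+ A :=
    AddMonoidHom.mk' (fun H => constantCoeff (vder H i)) fun H F => by simp [vder_add]
  have hC : ∀ c : A, f (C c) = 0 := fun c => by simp [f, vder]
  have hX : ∀ (p : JetRing m Γ N A) (w : JetVar m Γ N), f (p * X w) =
      if w.1 = i then jetAdj m Γ w.2 (constantCoeff p) else 0 :=
    fun p w => constantCoeff_vder_mul_X p w i
  have hp : ∀ c : Fin N → A, f (pair (C ∘ c) (gen m Γ N A)) = c i := by
    intro c
    simp only [pair, gen, Function.comp_apply, map_sum, hX]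
    simp [jetAdj_one_zero]
  have hf := eq_of_cls_eq m Γ f ?_ ?_ h
  · rwa [hp, hp] at hf
  · intro l H
    induction H using MvPolynomial.induction_on with
    | C a => simp [hC]
    | add p q hp hq => simp [hp, hq]
    | mul_X p v _ =>
      simp only [DDRing.d_mul, d_X, map_add, hX, ddComm_constantCoeff.map_d]
      split_ifs
      · have h1 : jetAdj m Γ (v.2.1, v.2.2 + Pi.single l 1) (constantCoeff p) =
            - jetAdj m Γ v.2 ((DDRing.d Γ l : A →+ A) (constantCoeff p)) := by
          simp only [jetAdj]
          rw [DDRing.shift_d, dpow_add_single,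
            ← map_dpow (DDRing.d Γ l : A →+ A) fun k x => DDRing.d_comm l k x]
          simp [Finset.sum_add_distrib, pow_succ]
        rw [h1, neg_add_cancel]
      · simp
  · intro g H
    induction H using MvPolynomial.induction_on with
    | C a => simp [hC]
    | add p q hp hq => simp [hp, hq]
    | mul_X p v _ =>
      simp only [map_mul, shift_X, hX, ddComm_constantCoeff.map_shift]
      simp [jetAdj]

omit [DDRing m Γ A] in
theorem derivation_evalJet [Algebra A T] (D : Derivation A T T) (U : Fin N → T)
    (H : JetRing m Γ N A) :
    D (evalJet U H) =
      ∑ v ∈ H.vars, evalJet U (pderiv v H) * D (jet m Γ v.2 (U v.1)) := by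
  classical
  -- Finite sets of variables which contain a fixed one are easier to carry through the induction
  -- than `H.vars`, which is not additive.
  have key : ∃ s₀ : Finset (JetVar m Γ N), ∀ s, s₀ ⊆ s → D (evalJet U H) =
      ∑ v ∈ s, evalJet U (pderiv v H) * D (jet m Γ v.2 (U v.1)) := by
    induction H using MvPolynomial.induction_on with
    | C a => exact ⟨∅, fun s _ => by simp [← algebraMap_eq]⟩
    | add p q hp hq =>
      obtain ⟨s, hs⟩ := hp
      obtain ⟨t, ht⟩ := hq
      refine ⟨s ∪ t, fun r hr => ?_⟩
      rw [map_add, map_add, hs r (Finset.union_subset_left hr), ht r (Finset.union_subset_right hr),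
        ← Finset.sum_add_distrib]
      simp [add_mul]
    | mul_X p w hp =>
      obtain ⟨s, hs⟩ := hp
      refine ⟨insert w s, fun r hr => ?_⟩
      rw [Finset.insert_subset_iff] at hr
      rw [map_mul, Derivation.leibniz, hs r hr.2]
      have h1 : ∀ v, evalJet U (pderiv v (p * X w)) * D (jet m Γ v.2 (U v.1)) =
          (if v = w then evalJet U p * D (jet m Γ w.2 (U w.1)) else 0) +
            evalJet U (X w : JetRing m Γ N A) *
              (evalJet U (pderiv v p) * D (jet m Γ v.2 (U v.1))) := by
        intro v
        by_cases h : v = w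
        · subst h
          simp
          ring
        · simp [pderiv_X, h, Ne.symm h]
          ring
      simp only [h1, Finset.sum_add_distrib, Finset.sum_ite_eq', hr.1, if_true, Finset.mul_sum,
        smul_eq_mul, evalJet_X]
  obtain ⟨s, hs⟩ := key
  rw [hs _ (Finset.subset_union_left (s₂ := H.vars))]
  refine (Finset.sum_subset Finset.subset_union_right fun v _ hv => ?_).symm
  rw [pderiv_eq_zero_of_notMem_vars hv, map_zero, zero_mul]

/-- The chain rule for the functional derivative along the evaluation at `U`. -/
theorem cls_derivation_evalJet [Algebra A T] (hAT : DDComm m Γ (algebraMap A T))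
    (D : Derivation A T T) (hD : DDComm m Γ D)
    (U : Fin N → T) (H : JetRing m Γ N A) :
    cls m Γ (D (evalJet U H)) =
      cls m Γ (pair (D ∘ U) (evalJet U ∘ vder H)) := by
  rw [derivation_evalJet]
  simp only [pair, vder, Function.comp_apply, map_sum, Finset.mul_sum]
  rw [Finset.sum_congr rfl fun v _ => by rw [hD.map_jet, cls_mul_jet]]
  rw [← Finset.sum_fiberwise (s := H.vars) (g := fun v => v.1)]
  refine Finset.sum_congr rfl fun i _ => Finset.sum_congr rfl fun v hv => ?_
  rw [(ddComm_evalJet hAT U).map_jetAdj, (Finset.mem_filter.1 hv).2, mul_comm]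

@[simp] theorem evol_X (W : Fin N → JetRing m Γ N A) (v : JetVar m Γ N) :
    evol W (X v) = jet m Γ v.2 (W v.1) := mkDerivation_X _ _ _

theorem evol_gen (W : Fin N → JetRing m Γ N A) (i : Fin N) :
    evol W (gen m Γ N A i) = W i := by
  rw [gen, evol_X, jet_one_zero]

theorem evol_comp_gen (W : Fin N → JetRing m Γ N A) : evol W ∘ gen m Γ N A = W := by
  funext i
  exact evol_gen W i

theorem ddComm_evol (W : Fin N → JetRing m Γ N A) : DDComm m Γ (evol W) where
  map_add a b := map_add _ a b
  map_d l a := by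
    induction a using MvPolynomial.induction_on with
    | C a => simp
    | add p q hp hq => simp [hp, hq]
    | mul_X p v hp =>
      simp only [DDRing.d_mul, d_X, map_add, Derivation.leibniz, hp, evol_X, smul_eq_mul, d_jet]
      ring
  map_shift g a := by
    induction a using MvPolynomial.induction_on with
    | C a => simp
    | add p q hp hq => simp [hp, hq]
    | mul_X p v hp =>
      simp only [map_mul, shift_X, map_add, Derivation.leibniz, hp, evol_X, smul_eq_mul, shift_jet]

/-- The functional derivative represents the action of evolution derivations:
`D_W(H) ∼ ⟨W, δH/δu⟩`. -/
theorem cls_evol (W : Fin N → JetRing m Γ N A) (H : JetRing m Γ N A) :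
    cls m Γ (evol W H) = cls m Γ (pair W (vder H)) := by
  have h := cls_derivation_evalJet ddComm_C (evol W) (ddComm_evol W) (gen m Γ N A) H
  have h1 : evol W ∘ gen m Γ N A = W := evol_comp_gen W
  have h2 : evalJet (gen m Γ N A) ∘ vder H = vder H := by
    funext i
    exact evalJet_gen_self (vder H i)
  rwa [evalJet_gen_self, h1, h2] at h

theorem evol_commutator (V W : Fin N → JetRing m Γ N A) (H : JetRing m Γ N A) :
    evol V (evol W H) - evol W (evol V H) =
      evol (evol V ∘ W - evol W ∘ V) H := by
  induction H using MvPolynomial.induction_on with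
  | C a => simp
  | add p q hp hq =>
    simp only [map_add, ← hp, ← hq]
    abel
  | mul_X p v hp =>
    have h1 : ∀ a b : JetRing m Γ N A, jet m Γ v.2 (a - b) = jet m Γ v.2 a - jet m Γ v.2 b :=
      fun a b => by rw [sub_eq_add_neg, jet_add, jet_neg, sub_eq_add_neg]
    simp only [Derivation.leibniz, map_add, smul_eq_mul, evol_X, (ddComm_evol _).map_jet, ← hp,
      Pi.sub_apply, Function.comp_apply, h1]
    ring

theorem evol_add (V W : Fin N → JetRing m Γ N A) : evol (V + W) = evol V + evol W :=
  MvPolynomial.derivation_ext fun v => by simp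

theorem evol_neg (V : Fin N → JetRing m Γ N A) : evol (-V) = -evol V :=
  MvPolynomial.derivation_ext fun v => by simp

theorem map_evol {S : Type*} [CommRing S] [DDRing m Γ S] (f : A →+* S) (hf : DDComm m Γ f)
    (W : Fin N → JetRing m Γ N A) (H : JetRing m Γ N A) :
    map f (evol W H) = evol (map f ∘ W) (map f H) := by
  induction H using MvPolynomial.induction_on with
  | C a => simp
  | add p q hp hq => simp [hp, hq]
  | mul_X p v hp => simp [hp, (ddComm_map f hf).map_jet]

/-- A vector over the jet ring is determined by its pairings, modulo `∼`, with the vectors over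
its scalar extensions. -/
theorem eq_of_cls_pair_map {K J : Fin N → JetRing m Γ N A}
    (h : cls m Γ (pair (map (C : A →+* JetRing m Γ N A) ∘ K) (C ∘ gen m Γ N A)) =
      cls m Γ (pair (map (C : A →+* JetRing m Γ N A) ∘ J) (C ∘ gen m Γ N A))) :
    K = J := by
  -- The homomorphism `R[w][u] → R[u][w]` exchanging the two sets of variables; after it,
  -- nondegeneracy applies with coefficients in `R[u]`.
  let s : JetRing m Γ N (JetRing m Γ N A) →+* JetRing m Γ N (JetRing m Γ N A) :=
    eval₂Hom (map C) fun v => C (X v)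
  have hs : DDComm m Γ s := by
    constructor
    · intro a b; exact map_add _ a b
    · intro l a
      induction a using MvPolynomial.induction_on with
      | C a => simp [s, (ddComm_map _ ddComm_C).map_d]
      | add p q hp hq => simp [hp, hq]
      | mul_X p v hp => simp [DDRing.d_mul, hp]; simp [s]
    · intro g a
      induction a using MvPolynomial.induction_on with
      | C a => simp [s, (ddComm_map _ ddComm_C).map_shift]
      | add p q hp hq => simp [hp, hq]
      | mul_X p v hp => simp [hp]; simp [s]
  have hm : ∀ p : JetRing m Γ N A, s (map C p) = C p := by
    intro p
    induction p using MvPolynomial.induction_on with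
    | C a => simp [s]
    | add p q hp hq => simp [hp, hq]
    | mul_X p v hp => simp [hp]; simp [s]
  have hg : ∀ i, s (C (gen m Γ N A i)) = gen m Γ N (JetRing m Γ N A) i := by
    intro i; simp [s, gen]
  have h' := hs.cls_eq h
  simp only [pair, Function.comp_apply, map_sum s, map_mul s, hm, hg] at h'
  exact eq_of_cls_pair_gen h'

end VariationalCalculus

/-! ### Operators, adjoints and the coadjoint action -/

section Pairing

variable {N : ℕ} {T : Type*} [CommRing T]

theorem pair_comm (U x : Fin N → T) : pair U x = pair x U := by simp [pair, mul_comm]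

@[simp] theorem pair_add_left (U V x : Fin N → T) : pair (U + V) x = pair U x + pair V x := by
  simp [pair, add_mul, Finset.sum_add_distrib]

@[simp] theorem pair_neg_left (U x : Fin N → T) : pair (-U) x = -pair U x := by simp [pair]

@[simp] theorem pair_sub_left (U V x : Fin N → T) : pair (U - V) x = pair U x - pair V x := by
  rw [sub_eq_add_neg, pair_add_left, pair_neg_left, sub_eq_add_neg]

@[simp] theorem pair_add_right (U x y : Fin N → T) : pair U (x + y) = pair U x + pair U y := by
  simp [pair, mul_add, Finset.sum_add_distrib]

@[simp] theorem pair_neg_right (U x : Fin N → T) : pair U (-x) = -pair U x := by simp [pair]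

@[simp] theorem pair_sub_right (U x y : Fin N → T) : pair U (x - y) = pair U x - pair U y := by
  rw [sub_eq_add_neg, pair_add_right, pair_neg_right, sub_eq_add_neg]

@[simp] theorem pair_smul_left (c : T) (U x : Fin N → T) : pair (c • U) x = c * pair U x := by
  simp [pair, Finset.mul_sum, mul_assoc]

@[simp] theorem pair_smul_right (c : T) (U x : Fin N → T) : pair U (c • x) = c * pair U x := by
  simp [pair, Finset.mul_sum, mul_left_comm]

end Pairing

section OperatorCalculus

variable {m : ℕ} {Γ : Type*} [Group Γ] {R : Type*} [CommRing R] {M N : ℕ}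
  {T : Type*} [CommRing T] [Algebra R T] [DDRing m Γ T]
  {T' : Type*} [CommRing T'] [Algebra R T'] [DDRing m Γ T']

variable (m Γ R) in
/-- Maps of differential-difference `R`-algebras which commute with every operator with
coefficients in `R`. -/
structure DDLin (f : T → T') : Prop extends DDComm m Γ f where
  map_scalar : ∀ (r : R) (t : T), f (algebraMap R T r * t) = algebraMap R T' r * f t

variable (m Γ R) in
/-- Derivations of a differential-difference `R`-algebra which kill `R` and commute with all `∂ₗ`
and `ĝ`. -/
structure DDDer (D : T → T) : Prop extends DDComm m Γ D where
  leibniz : ∀ a b : T, D (a * b) = a * D b + D a * b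
  map_algebraMap : ∀ r : R, D (algebraMap R T r) = 0

theorem DDDer.ddLin {D : T → T} (hD : DDDer m Γ R D) : DDLin m Γ R D where
  toDDComm := hD.toDDComm
  map_scalar r t := by rw [hD.leibniz, hD.map_algebraMap, zero_mul, add_zero]

theorem DDComm.ddLin_algHom {f : T →ₐ[R] T'} (hf : DDComm m Γ f) : DDLin m Γ R f where
  toDDComm := hf
  map_scalar r t := by simp

theorem IsConst.ddLin {c : T} (hc : IsConst m Γ c) :
    DDLin m Γ R (fun t : T => c * t) where
  map_add := mul_add c
  map_d l a := by simp [DDRing.d_mul, hc.1 l]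
  map_shift g a := by simp [hc.2 g]
  map_scalar r t := mul_left_comm _ _ _

theorem DDDer.map_pair {D : T → T} (hD : DDDer m Γ R D) (U x : Fin N → T) :
    D (pair U x) = pair (D ∘ U) x + pair U (D ∘ x) := by
  simp [pair, hD.map_sum, hD.leibniz, Finset.sum_add_distrib, add_comm]

theorem DDOp.app_add (P : DDOp m Γ R M N) (x y : Fin N → T) :
    P.app (x + y) = P.app x + P.app y := by
  funext k
  simp [DDOp.app, Finsupp.sum, mul_add, Finset.sum_add_distrib]

theorem DDOp.app_neg (P : DDOp m Γ R M N) (x : Fin N → T) : P.app (-x) = -P.app x := by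
  funext k
  simp [DDOp.app, Finsupp.sum]

theorem DDOp.app_sub (P : DDOp m Γ R M N) (x y : Fin N → T) :
    P.app (x - y) = P.app x - P.app y := by
  rw [sub_eq_add_neg, app_add, app_neg, sub_eq_add_neg]

theorem DDLin.map_app {f : T → T'} (hf : DDLin m Γ R f) (P : DDOp m Γ R M N) (x : Fin N → T) :
    f ∘ P.app x = P.app (f ∘ x) := by
  funext k
  simp [DDOp.app, Finsupp.sum, hf.map_sum, hf.map_scalar, hf.map_jet]

theorem DDLin.map_adj {f : T → T'} (hf : DDLin m Γ R f) (P : DDOp m Γ R M N) (y : Fin M → T) :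
    f ∘ P.adj y = P.adj (f ∘ y) := by
  funext k
  simp [DDOp.adj, Finsupp.sum, hf.map_sum, hf.map_scalar, hf.map_jetAdj]

theorem DDOp.app_smul (P : DDOp m Γ R M N) {c : T} (hc : IsConst m Γ c) (x : Fin N → T) :
    P.app (c • x) = c • P.app x :=
  (hc.ddLin.map_app P x).symm

theorem DDOp.adj_sub (P : DDOp m Γ R M N) (x y : Fin M → T) :
    P.adj (x - y) = P.adj x - P.adj y := by
  funext k
  simp [DDOp.adj, Finsupp.sum, mul_add, Finset.sum_add_distrib, sub_eq_add_neg]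

/-- The formal adjoint `P†` is the adjoint with respect to the pairing, modulo `∼`. -/
theorem cls_pair_app (P : DDOp m Γ R M N) (U : Fin M → T) (x : Fin N → T) :
    cls m Γ (pair U (P.app x)) = cls m Γ (pair (P.adj U) x) := by
  simp only [pair, DDOp.app, DDOp.adj, Finsupp.sum, Finset.mul_sum, Finset.sum_mul, map_sum]
  rw [Finset.sum_comm]
  refine Finset.sum_congr rfl fun i _ => Finset.sum_congr rfl fun k _ =>
    Finset.sum_congr rfl fun p _ => ?_
  rw [← cls_mul_jet]
  congr 1
  ring

variable (c : DDBilin m Γ R N)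

theorem DDBilin.app_neg_right (x y : Fin N → T) : c.app x (-y) = -c.app x y := by
  funext k
  simp [DDBilin.app, Finsupp.sum]

theorem DDBilin.coad_add_left (x y U : Fin N → T) : c.coad (x + y) U = c.coad x U + c.coad y U := by
  funext k
  simp only [DDBilin.coad, Finsupp.sum, Pi.add_apply, jet_add, mul_add, add_mul, jetAdj_add,
    Finset.sum_add_distrib, neg_add]

theorem DDBilin.coad_add_right (x U V : Fin N → T) :
    c.coad x (U + V) = c.coad x U + c.coad x V := by
  funext k
  simp only [DDBilin.coad, Finsupp.sum, Pi.add_apply, mul_add, jetAdj_add,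
    Finset.sum_add_distrib, neg_add]

theorem DDBilin.coad_neg_left (x U : Fin N → T) : c.coad (-x) U = -c.coad x U := by
  funext k
  simp [DDBilin.coad, Finsupp.sum]

theorem DDBilin.coad_neg_right (x U : Fin N → T) : c.coad x (-U) = -c.coad x U := by
  funext k
  simp [DDBilin.coad, Finsupp.sum]

theorem DDBilin.coad_smul_left {a : T} (ha : IsConst m Γ a) (x U : Fin N → T) :
    c.coad (a • x) U = a • c.coad x U := by
  have h := ha.ddLin (R := R)
  funext j
  simp only [DDBilin.coad, Finsupp.sum, Pi.smul_apply, smul_eq_mul, mul_neg, Finset.mul_sum]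
  refine congrArg Neg.neg (Finset.sum_congr rfl fun k _ => Finset.sum_congr rfl fun i _ =>
    Finset.sum_congr rfl fun p _ => ?_)
  rw [← h.map_jet, h.map_jetAdj]
  congr 1
  ring

theorem DDBilin.coad_smul_right {a : T} (ha : IsConst m Γ a) (x U : Fin N → T) :
    c.coad x (a • U) = a • c.coad x U := by
  have h := ha.ddLin (R := R)
  funext j
  simp only [DDBilin.coad, Finsupp.sum, Pi.smul_apply, smul_eq_mul, mul_neg, Finset.mul_sum]
  refine congrArg Neg.neg (Finset.sum_congr rfl fun k _ => Finset.sum_congr rfl fun i _ =>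
    Finset.sum_congr rfl fun p _ => ?_)
  rw [h.map_jetAdj]
  congr 1
  ring

theorem cls_pair_coad (x U y : Fin N → T) :
    cls m Γ (pair (c.coad x U) y) = -cls m Γ (pair U (c.app x y)) := by
  simp only [pair, DDBilin.app, DDBilin.coad, Finsupp.sum, Finset.mul_sum, Finset.sum_mul, neg_mul,
    Finset.sum_neg_distrib, map_neg, map_sum]
  congr 1
  rw [Finset.sum_comm]
  refine Finset.sum_congr rfl fun k _ => ?_
  rw [Finset.sum_comm]
  refine Finset.sum_congr rfl fun i _ => Finset.sum_congr rfl fun j _ =>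
    Finset.sum_congr rfl fun p _ => ?_
  rw [← cls_mul_jet]
  congr 1
  ring

theorem map_bilinApp {f : T →ₐ[R] T'} (hf : DDComm m Γ f) (x y : Fin N → T) :
    f ∘ c.app x y = c.app (f ∘ x) (f ∘ y) := by
  funext k
  simp [DDBilin.app, Finsupp.sum, hf.map_jet]

theorem map_coad {f : T →ₐ[R] T'} (hf : DDComm m Γ f) (x U : Fin N → T) :
    f ∘ c.coad x U = c.coad (f ∘ x) (f ∘ U) := by
  funext k
  simp [DDBilin.coad, Finsupp.sum, hf.map_jet, hf.map_jetAdj]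

theorem DDDer.map_coad {D : T → T} (hD : DDDer m Γ R D) (x U : Fin N → T) :
    D ∘ c.coad x U = c.coad (D ∘ x) U + c.coad x (D ∘ U) := by
  funext k
  simp only [DDBilin.coad, Finsupp.sum, Function.comp_apply, hD.map_neg, hD.map_sum, hD.map_jetAdj,
    hD.leibniz, hD.map_jet, hD.map_algebraMap, Pi.add_apply, zero_mul, add_zero, jetAdj_add,
    Finset.sum_add_distrib]
  abel

end OperatorCalculus

section Extensions

variable {m : ℕ} {Γ : Type*} [Group Γ] {N : ℕ} {R : Type*} [CommRing R] [DDRing m Γ R]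
  {S : Type*} [CommRing S] [DDRing m Γ S] [Algebra R S]

theorem IsDDExt.ddComm (h : IsDDExt m Γ R S) : DDComm m Γ (algebraMap R S) where
  map_add a b := map_add _ a b
  map_d := h.map_d
  map_shift := h.map_shift

theorem isDDExt_refl : IsDDExt m Γ R R := ⟨fun _ _ h => h, fun _ _ => rfl, fun _ _ => rfl⟩

theorem IsDDExt.jetRing (h : IsDDExt m Γ R S) : IsDDExt m Γ R (JetRing m Γ N S) where
  injective a b hab := by
    rw [MvPolynomial.algebraMap_apply, MvPolynomial.algebraMap_apply] at hab
    exact h.injective (MvPolynomial.C_injective _ _ hab)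
  map_d l a := by rw [MvPolynomial.algebraMap_apply, MvPolynomial.algebraMap_apply, d_C, h.map_d]
  map_shift l a := by
    rw [MvPolynomial.algebraMap_apply, MvPolynomial.algebraMap_apply, shift_C, h.map_shift]

omit [DDRing m Γ R] in
theorem ddDer_evol (W : Fin N → JetRing m Γ N S) : DDDer m Γ R (evol W) where
  toDDComm := ddComm_evol W
  leibniz a b := by simp [mul_comm]
  map_algebraMap r := by rw [MvPolynomial.algebraMap_apply]; simp

theorem isConst_C {c : S} (hc : IsConst m Γ c) :
    IsConst m Γ (MvPolynomial.C c : JetRing m Γ N S) :=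
  ⟨fun l => by rw [d_C, hc.1 l, map_zero], fun g => by rw [shift_C, hc.2 g]⟩

theorem IsConst.algebraMap (h : IsDDExt m Γ R S) {c : R} (hc : IsConst m Γ c) :
    IsConst m Γ (algebraMap R S c) :=
  ⟨fun l => by rw [← h.map_d, hc.1 l, map_zero], fun g => by rw [← h.map_shift, hc.2 g]⟩

/-- Vectors over `S` are determined by their pairings, modulo `∼`, with the vectors over a larger
extension. -/
theorem eq_of_cls_pair_C {a b : Fin N → S}
    (h : ∀ y : Fin N → JetRing m Γ N S, cls m Γ (pair (MvPolynomial.C ∘ a) y) =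
      cls m Γ (pair (MvPolynomial.C ∘ b) y)) : a = b :=
  eq_of_cls_pair_gen (h _)

end Extensions

section Lie

variable {m : ℕ} {Γ : Type v} [Group Γ] {R : Type u} [CommRing R] [DDRing m Γ R] {N M : ℕ}
  (L : DDLie.{u, v} m Γ R N)

section Linear

variable {T : Type w} [CommRing T] [Algebra R T] [DDRing m Γ T]

theorem DDLie.coad_add_left (x y U : Fin N → T) :
    L.coad (x + y) U = L.coad x U + L.coad y U := L.c.coad_add_left x y U

theorem DDLie.coad_add_right (x U V : Fin N → T) :
    L.coad x (U + V) = L.coad x U + L.coad x V := L.c.coad_add_right x U V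

theorem DDLie.coad_neg_left (x U : Fin N → T) : L.coad (-x) U = -L.coad x U :=
  L.c.coad_neg_left x U

theorem DDLie.coad_neg_right (x U : Fin N → T) : L.coad x (-U) = -L.coad x U :=
  L.c.coad_neg_right x U

theorem DDLie.coad_sub_left (x y U : Fin N → T) :
    L.coad (x - y) U = L.coad x U - L.coad y U := by
  rw [sub_eq_add_neg, L.coad_add_left, L.coad_neg_left, sub_eq_add_neg]

theorem DDLie.coad_sub_right (x U V : Fin N → T) :
    L.coad x (U - V) = L.coad x U - L.coad x V := by
  rw [sub_eq_add_neg, L.coad_add_right, L.coad_neg_right, sub_eq_add_neg]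

theorem DDLie.map_coad {T' : Type*} [CommRing T'] [Algebra R T'] [DDRing m Γ T'] {f : T →ₐ[R] T'}
    (hf : DDComm m Γ f) (x U : Fin N → T) : f ∘ L.coad x U = L.coad (f ∘ x) (f ∘ U) :=
  DiffDiff.map_coad L.c hf x U

theorem DDLie.map_brac {T' : Type*} [CommRing T'] [Algebra R T'] [DDRing m Γ T'] {f : T →ₐ[R] T'}
    (hf : DDComm m Γ f) (x y : Fin N → T) : f ∘ L.brac x y = L.brac (f ∘ x) (f ∘ y) :=
  DiffDiff.map_bilinApp L.c hf x y

theorem DDLie.derivation_coad {D : T → T} (hD : DDDer m Γ R D) (x U : Fin N → T) :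
    D ∘ L.coad x U = L.coad (D ∘ x) U + L.coad x (D ∘ U) :=
  hD.map_coad L.c x U

theorem DDLie.cls_pair_coad (x U y : Fin N → T) :
    cls m Γ (pair (L.coad x U) y) = -cls m Γ (pair U (L.brac x y)) :=
  DiffDiff.cls_pair_coad L.c x U y

theorem DDLie.brac_neg_right (x y : Fin N → T) : L.brac x (-y) = -L.brac x y :=
  L.c.app_neg_right x y

end Linear

variable {T : Type (max u v)} [CommRing T] [Algebra R T] [DDRing m Γ T]

theorem DDLie.brac_skew (hT : IsDDExt m Γ R T) (x y : Fin N → T) : L.brac x y = -L.brac y x :=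
  L.skew T hT x y

/-- Since the commutator is skew, `⟨x.U, y⟩` is skew in `x` and `y` modulo `∼`. -/
theorem DDLie.cls_pair_coad' (hT : IsDDExt m Γ R T) (x U y : Fin N → T) :
    cls m Γ (pair (L.coad x U) y) = -cls m Γ (pair (L.coad y U) x) := by
  rw [L.cls_pair_coad, L.cls_pair_coad, L.brac_skew hT]
  simp

theorem C_comp_coad (x U : Fin N → T) :
    (MvPolynomial.C ∘ L.coad x U : Fin N → JetRing m Γ M T) =
      L.coad (MvPolynomial.C ∘ x) (MvPolynomial.C ∘ U) :=
  L.map_coad (f := IsScalarTower.toAlgHom R T (JetRing m Γ M T)) ddComm_C x U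

theorem C_comp_brac (x y : Fin N → T) :
    (MvPolynomial.C ∘ L.brac x y : Fin N → JetRing m Γ M T) =
      L.brac (MvPolynomial.C ∘ x) (MvPolynomial.C ∘ y) :=
  L.map_brac (f := IsScalarTower.toAlgHom R T (JetRing m Γ M T)) ddComm_C x y

/-- The coadjoint action is an action of the Lie algebra: paired with a generic vector `z`, this is
the Jacobi identity. -/
theorem DDLie.coad_brac (hT : IsDDExt m Γ R T) (x y U : Fin N → T) :
    L.coad (L.brac x y) U = L.coad x (L.coad y U) - L.coad y (L.coad x U) := by
  refine eq_of_cls_pair_C (m := m) (Γ := Γ) fun z => ?_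
  have hC : ∀ V W : Fin N → T, (MvPolynomial.C ∘ (V - W) : Fin N → JetRing m Γ N T) =
    MvPolynomial.C ∘ V - MvPolynomial.C ∘ W := fun V W => by funext i; simp
  rw [hC]
  simp only [C_comp_coad, C_comp_brac, pair_sub_left, map_sub, L.cls_pair_coad]
  generalize (MvPolynomial.C ∘ x : Fin N → JetRing m Γ N T) = x'
  generalize (MvPolynomial.C ∘ y : Fin N → JetRing m Γ N T) = y'
  have h := L.jacobi (JetRing m Γ N T) hT.jetRing x' y' z
  change L.brac (L.brac x' y') z + L.brac (L.brac y' z) x' + L.brac (L.brac z x') y' = 0 at h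
  rw [L.brac_skew hT.jetRing (L.brac y' z), L.brac_skew hT.jetRing (L.brac z x'),
    L.brac_skew hT.jetRing z x', L.brac_neg_right, neg_neg] at h
  have h' := congrArg (fun V => cls m Γ (pair (MvPolynomial.C ∘ U) V)) h
  simp only [pair_add_right, pair_neg_right, map_add, map_neg] at h'
  have h0 : cls m Γ (pair (MvPolynomial.C ∘ U) (0 : Fin N → JetRing m Γ N T)) = 0 := by
    simp [pair]
  rw [h0] at h'
  simp only [neg_neg]
  rw [← sub_eq_zero, ← neg_eq_zero, ← h']
  abel

end Lie

/-! ### The pencil of Hamiltonian operators -/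

open MvPolynomial

section Hessian

variable {m : ℕ} {Γ : Type*} [Group Γ] {N : ℕ} {A : Type*} [CommRing A] [DDRing m Γ A]

/-- The second variational derivative is symmetric. -/
theorem cls_pair_evol_vder_comm (V W : Fin N → JetRing m Γ N A) (H : JetRing m Γ N A) :
    cls m Γ (pair V (evol W ∘ vder H)) = cls m Γ (pair W (evol V ∘ vder H)) := by
  have key : ∀ V W : Fin N → JetRing m Γ N A, cls m Γ (evol V (evol W H)) =
      cls m Γ (pair (evol V ∘ W) (vder H)) + cls m Γ (pair W (evol V ∘ vder H)) := by
    intro V W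
    rw [(ddComm_evol V).cls_eq (cls_evol W H), (ddDer_evol (R := A) V).map_pair, map_add]
  have h := congrArg (cls m Γ) (evol_commutator V W H)
  rw [map_sub, key, key, cls_evol, pair_sub_left, map_sub] at h
  rw [← sub_eq_zero] at h ⊢
  rw [← neg_eq_zero, ← h]
  abel

end Hessian

section Pencil

variable {m : ℕ} {Γ : Type v} [Group Γ] {R : Type u} [CommRing R] [DDRing m Γ R] {N : ℕ}
  (L : DDLie.{u, v} m Γ R N) (O P : DDOp m Γ R N N) (e : Fin 3 → R)

section Def

variable {T : Type w} [CommRing T] [Algebra R T] [DDRing m Γ T]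

/-- The pencil `B_U(Y) = e₀ P(Y) - e₁ Y.U + e₂ O(Y.U).U` of Hamiltonian operators, at the
point `U`. -/
def pencil (U Y : Fin N → T) : Fin N → T :=
  algebraMap R T (e 0) • P.app Y - algebraMap R T (e 1) • L.coad Y U +
    algebraMap R T (e 2) • L.coad (O.app (L.coad Y U)) U

/-- The derivative of `U ↦ B_U(Y)` in the direction `W`. -/
def pencilDeriv (U W Y : Fin N → T) : Fin N → T :=
  -(algebraMap R T (e 1) • L.coad Y W) +
    algebraMap R T (e 2) • (L.coad (O.app (L.coad Y W)) U + L.coad (O.app (L.coad Y U)) W)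

/-- The vector `Q` with `⟨B'_W(Y), Z⟩ ∼ ⟨W, Q⟩` for all `W`, where `B'_W` is the derivative of the
pencil in the direction `W`. -/
def pencilAdj (U Y Z : Fin N → T) : Fin N → T :=
  algebraMap R T (e 1) • L.brac Y Z +
    algebraMap R T (e 2) • (L.brac (O.app (L.coad Z U)) Y - L.brac (O.app (L.coad Y U)) Z)

end Def

/-- The conditions on the data of a pencil which make it a Hamiltonian operator.  The operator `P` is
a skew-symmetric one-cocycle, and `e₀ (O P - 1) = e₀ (P O - 1) = 0`; the last condition covers both
`P = O⁻¹` with arbitrary `e₀` and the pencil without a constant-coefficient term (`P = 0`,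
`e₀ = 0`), where `O` need not be invertible. -/
structure IsPencil : Prop where
  oOperator : IsOOperator L O
  const : ∀ j, IsConst m Γ (e j)
  skew : ∀ (S : Type (max u v)) [CommRing S] [Algebra R S] [DDRing m Γ S], IsDDExt m Γ R S →
    ∀ x y : Fin N → S, Sim m Γ (pair (P.app x) y) (-pair (P.app y) x)
  cocycle : ∀ (S : Type (max u v)) [CommRing S] [Algebra R S] [DDRing m Γ S], IsDDExt m Γ R S →
    ∀ x y : Fin N → S, P.app (L.brac x y) = L.coad x (P.app y) - L.coad y (P.app x)
  right_inv : ∀ (S : Type (max u v)) [CommRing S] [Algebra R S] [DDRing m Γ S],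
    IsDDExt m Γ R S → ∀ x : Fin N → S,
      algebraMap R S (e 0) • O.app (P.app x) = algebraMap R S (e 0) • x
  left_inv : ∀ (S : Type (max u v)) [CommRing S] [Algebra R S] [DDRing m Γ S],
    IsDDExt m Γ R S → ∀ x : Fin N → S,
      algebraMap R S (e 0) • P.app (O.app x) = algebraMap R S (e 0) • x

variable {L O P e}

section Identities

variable {T : Type (max u v)} [CommRing T] [Algebra R T] [DDRing m Γ T]

theorem IsConst.cls_mul {c a b : T} (hc : IsConst m Γ c) (h : cls m Γ a = cls m Γ b) :
    cls m Γ (c * a) = cls m Γ (c * b) :=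
  (hc.ddLin (R := T)).cls_eq h

/-- `⟨O(Y.U).W, Z⟩ ∼ -⟨Z.W, O(Y.U)⟩ ∼ ⟨Y.U, O(Z.W)⟩`. -/
theorem IsOOperator.cls_pair_coad (hO : IsOOperator L O) (hT : IsDDExt m Γ R T)
    (V W Z : Fin N → T) :
    cls m Γ (pair (L.coad (O.app V) W) Z) = cls m Γ (pair V (O.app (L.coad Z W))) := by
  rw [L.cls_pair_coad' hT, (sim_iff m Γ).1 (hO.skew T hT _ _), map_neg, neg_neg]

theorem cls_pair_pencil_skew (h : IsPencil L O P e) (hT : IsDDExt m Γ R T)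
    (U Y Z : Fin N → T) :
    cls m Γ (pair (pencil L O P e U Y) Z) = -cls m Γ (pair (pencil L O P e U Z) Y) := by
  have hc : ∀ j, IsConst m Γ (algebraMap R T (e j)) := fun j => (h.const j).algebraMap hT
  have h0 := (hc 0).cls_mul ((sim_iff m Γ).1 (h.skew T hT Y Z))
  have h1 : cls m Γ (pair (L.coad Y U) Z) = cls m Γ (-pair (L.coad Z U) Y) := by
    rw [L.cls_pair_coad' hT, map_neg]
  have h2 : cls m Γ (pair (L.coad (O.app (L.coad Y U)) U) Z) =
      cls m Γ (-pair (L.coad (O.app (L.coad Z U)) U) Y) := by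
    rw [h.oOperator.cls_pair_coad hT, map_neg, h.oOperator.cls_pair_coad hT,
      (sim_iff m Γ).1 (h.oOperator.skew T hT _ _), map_neg]
  have h1' := (hc 1).cls_mul h1
  have h2' := (hc 2).cls_mul h2
  simp only [pencil, pair_add_left, pair_sub_left, pair_smul_left, map_add, map_sub, h0, h1', h2']
  simp only [mul_neg, map_neg]
  abel

theorem map_pencil {T' : Type w} [CommRing T'] [Algebra R T'] [DDRing m Γ T'] {f : T →ₐ[R] T'}
    (hf : DDComm m Γ f) (U Y : Fin N → T) :
    f ∘ pencil L O P e U Y = pencil L O P e (f ∘ U) (f ∘ Y) := by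
  have h1 : ∀ U Y : Fin N → T, f ∘ L.coad Y U = L.coad (f ∘ Y) (f ∘ U) := fun U Y =>
    L.map_coad hf Y U
  have h2 : ∀ (Q : DDOp m Γ R N N) (Y : Fin N → T), f ∘ Q.app Y = Q.app (f ∘ Y) := fun Q Y =>
    hf.ddLin_algHom.map_app Q Y
  unfold pencil
  rw [← h1 U Y, ← h2 P Y, ← h2 O, ← h1 U (O.app _)]
  funext i
  simp

theorem map_pencilAdj {T' : Type w} [CommRing T'] [Algebra R T'] [DDRing m Γ T'] {f : T →ₐ[R] T'}
    (hf : DDComm m Γ f) (U Y Z : Fin N → T) :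
    f ∘ pencilAdj L O e U Y Z = pencilAdj L O e (f ∘ U) (f ∘ Y) (f ∘ Z) := by
  have h1 : ∀ U Y : Fin N → T, f ∘ L.coad Y U = L.coad (f ∘ Y) (f ∘ U) := fun U Y =>
    L.map_coad hf Y U
  have h2 : ∀ (Q : DDOp m Γ R N N) (Y : Fin N → T), f ∘ Q.app Y = Q.app (f ∘ Y) := fun Q Y =>
    hf.ddLin_algHom.map_app Q Y
  have h3 : ∀ x y : Fin N → T, f ∘ L.brac x y = L.brac (f ∘ x) (f ∘ y) := fun x y =>
    L.map_brac hf x y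
  unfold pencilAdj
  rw [← h1 U Y, ← h1 U Z, ← h2 O, ← h2 O, ← h3, ← h3, ← h3]
  funext i
  simp

theorem pencil_add (U Y Z : Fin N → T) :
    pencil L O P e U (Y + Z) = pencil L O P e U Y + pencil L O P e U Z := by
  simp only [pencil, DDOp.app_add, L.coad_add_left]
  module

theorem pencil_sub (U Y Z : Fin N → T) :
    pencil L O P e U (Y - Z) = pencil L O P e U Y - pencil L O P e U Z := by
  simp only [pencil, DDOp.app_sub, L.coad_sub_left]
  module

theorem DDDer.map_pencil {D : T → T} (hD : DDDer m Γ R D) (U Y : Fin N → T) :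
    D ∘ pencil L O P e U Y = pencil L O P e U (D ∘ Y) + pencilDeriv L O e U (D ∘ U) Y := by
  have h1 : ∀ U Y : Fin N → T, D ∘ L.coad Y U = L.coad (D ∘ Y) U + L.coad Y (D ∘ U) := fun U Y =>
    L.derivation_coad hD Y U
  have h2 : ∀ (Q : DDOp m Γ R N N) (Y : Fin N → T), D ∘ Q.app Y = Q.app (D ∘ Y) := fun Q Y =>
    hD.ddLin.map_app Q Y
  have h3 : ∀ a b c : Fin N → T,
      D ∘ (algebraMap R T (e 0) • a - algebraMap R T (e 1) • b + algebraMap R T (e 2) • c) =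
        algebraMap R T (e 0) • (D ∘ a) - algebraMap R T (e 1) • (D ∘ b) +
          algebraMap R T (e 2) • (D ∘ c) := by
    intro a b c
    funext i
    simp only [Function.comp_apply, Pi.add_apply, Pi.neg_apply, Pi.smul_apply, smul_eq_mul,
      sub_eq_add_neg, hD.map_add, hD.map_neg, hD.ddLin.map_scalar]
  simp only [pencil, pencilDeriv, h3, h1, h2, DDOp.app_add, L.coad_add_left]
  module

theorem cls_pair_pencilDeriv (h : IsPencil L O P e) (hT : IsDDExt m Γ R T)
    (U W Y Z : Fin N → T) :
    cls m Γ (pair (pencilDeriv L O e U W Y) Z) = cls m Γ (pair W (pencilAdj L O e U Y Z)) := by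
  have hc : ∀ j, IsConst m Γ (algebraMap R T (e j)) := fun j => (h.const j).algebraMap hT
  have h1 : cls m Γ (pair (L.coad Y W) Z) = cls m Γ (-pair W (L.brac Y Z)) := by
    rw [L.cls_pair_coad, map_neg]
  have h2 : cls m Γ (pair (L.coad (O.app (L.coad Y W)) U + L.coad (O.app (L.coad Y U)) W) Z) =
      cls m Γ (pair W (L.brac (O.app (L.coad Z U)) Y - L.brac (O.app (L.coad Y U)) Z)) := by
    rw [pair_add_left, pair_sub_right, map_add, map_sub, h.oOperator.cls_pair_coad hT,
      L.cls_pair_coad, L.cls_pair_coad, L.brac_skew hT Y, pair_neg_right, map_neg]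
    abel
  have h1' := (hc 1).cls_mul h1
  have h2' := (hc 2).cls_mul h2
  simp only [pencilDeriv, pencilAdj, pair_neg_left, pair_add_left _ (_ • _),
    pair_add_right _ (_ • _), pair_smul_left, pair_smul_right, map_add, map_neg, h1', h2']
  simp only [mul_neg, map_neg, neg_neg]

/-- The vanishing of the Schouten bracket of the pencil with itself.  Its part of bidegree `(i, j)` in
`e` follows from the cocycle identity for `(0, 1)`, from the cocycle identity and invertibility for
`(0, 2)`, from the coadjoint action for `(1, 1)` and `(1, 2)`, and from the defining identity of an
`O`-operator for `(2, 2)`. -/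
theorem pencil_pencilAdj (h : IsPencil L O P e) (hT : IsDDExt m Γ R T) (U Y Z : Fin N → T) :
    pencil L O P e U (pencilAdj L O e U Y Z) =
      pencilDeriv L O e U (pencil L O P e U Y) Z - pencilDeriv L O e U (pencil L O P e U Z) Y := by
  have hc : ∀ j, IsConst m Γ (algebraMap R T (e j)) := fun j => (h.const j).algebraMap hT
  have sl : ∀ j (x V : Fin N → T), L.coad (algebraMap R T (e j) • x) V =
      algebraMap R T (e j) • L.coad x V := fun j x V => L.c.coad_smul_left (hc j) x V
  have sr : ∀ j (x V : Fin N → T), L.coad x (algebraMap R T (e j) • V) =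
      algebraMap R T (e j) • L.coad x V := fun j x V => L.c.coad_smul_right (hc j) x V
  have sO : ∀ (Q : DDOp m Γ R N N) j (x : Fin N → T), Q.app (algebraMap R T (e j) • x) =
      algebraMap R T (e j) • Q.app x := fun Q j x => Q.app_smul (hc j) x
  -- the `O`-operator identity for `Z.U` and `Y.U`, acting on `U`
  have h3 : L.coad (O.app (L.coad (O.app (L.coad Z U)) (L.coad Y U))) U -
        L.coad (O.app (L.coad (O.app (L.coad Y U)) (L.coad Z U))) U =
      L.coad (O.app (L.coad Z U)) (L.coad (O.app (L.coad Y U)) U) -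
        L.coad (O.app (L.coad Y U)) (L.coad (O.app (L.coad Z U)) U) := by
    rw [← L.coad_brac hT, ← h.oOperator.hom T hT, ← L.coad_sub_left, ← DDOp.app_sub]
    rfl
  -- `O` applied to the cocycle identity `P [Y, Z] = Y.P(Z) - Z.P(Y)`, acting on `U`
  have h2 : algebraMap R T (e 0) • L.coad (O.app (L.coad Y (P.app Z))) U -
        algebraMap R T (e 0) • L.coad (O.app (L.coad Z (P.app Y))) U =
      algebraMap R T (e 0) • (L.coad Y (L.coad Z U) - L.coad Z (L.coad Y U)) := by
    rw [← L.coad_brac hT, ← smul_sub, ← L.coad_sub_left, ← DDOp.app_sub, ← h.cocycle T hT, ← sl,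
      h.right_inv T hT, sl]
  have h4 : ∀ x V : Fin N → T, algebraMap R T (e 0) • L.coad x (P.app (O.app V)) =
      algebraMap R T (e 0) • L.coad x V := by
    intro x V
    rw [← sr, h.left_inv T hT, sr]
  have h4Y := h4 Y (L.coad Z U)
  have h4Z := h4 Z (L.coad Y U)
  simp only [pencil, pencilAdj, pencilDeriv, L.coad_add_left, L.coad_add_right, L.coad_sub_left,
    L.coad_sub_right, DDOp.app_add, DDOp.app_sub, sl, sr, sO, L.coad_brac hT, h.cocycle T hT]
  generalize algebraMap R T (e 0) = a at *
  generalize algebraMap R T (e 1) = b at *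
  generalize algebraMap R T (e 2) = c at *
  linear_combination (norm := module) (c * c) • h3 + c • h2 - c • h4Y + c • h4Z

end Identities

section Jacobi

variable (L O P e) in
/-- The bracket with the Hamiltonian operator `e₀ P(Y) - e₁ Y.u + e₂ O(Y.u).u`. -/
noncomputable def pencilBr {S : Type w} [CommRing S] [Algebra R S] [DDRing m Γ S] (H F : JetRing m Γ N S) :
    JetRing m Γ N S :=
  bracketOf (pencil L O P e (gen m Γ N S)) H F

variable {S : Type (max u v)} [CommRing S] [Algebra R S] [DDRing m Γ S]

theorem cls_pencilBr {S : Type w} [CommRing S] [Algebra R S] [DDRing m Γ S]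
    (H F : JetRing m Γ N S) :
    cls m Γ (pencilBr L O P e H F) =
      cls m Γ (pair (pencil L O P e (gen m Γ N S) (vder H)) (vder F)) :=
  cls_evol _ F

/-- The functional derivative of `{H, F}`, paired with an arbitrary vector. -/
theorem cls_pair_vder_pencilBr (h : IsPencil L O P e) (hS : IsDDExt m Γ R S)
    (H F : JetRing m Γ N S) (W : Fin N → JetRing m Γ N S) :
    cls m Γ (pair W (vder (pencilBr L O P e H F))) =
      cls m Γ (pair W (evol (pencil L O P e (gen m Γ N S) (vder H)) ∘ vder F -
        evol (pencil L O P e (gen m Γ N S) (vder F)) ∘ vder H +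
        pencilAdj L O e (gen m Γ N S) (vder H) (vder F))) := by
  have hW : DDDer m Γ R (evol W) := ddDer_evol W
  rw [← cls_evol, (ddComm_evol W).cls_eq (cls_pencilBr H F), hW.map_pair, hW.map_pencil, evol_comp_gen,
    pair_add_left, pair_add_right, pair_sub_right, map_add, map_add, map_add, map_sub,
    cls_pair_pencilDeriv h hS.jetRing, cls_pair_pencil_skew h hS.jetRing,
    cls_pair_evol_vder_comm _ W H, cls_pair_evol_vder_comm _ W F]
  abel

/-- The scalar extension `R[u] → R[w][u]`. -/
noncomputable def extHom (m : ℕ) (Γ : Type v) [Group Γ] (R : Type u) [CommRing R] (N : ℕ) :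
    JetRing m Γ N R →ₐ[R] JetRing m Γ N (JetRing m Γ N R) :=
  mapAlgHom (Algebra.ofId R (JetRing m Γ N R))

theorem ddComm_extHom : DDComm m Γ (extHom m Γ R N) := ddComm_map C ddComm_C

theorem vder_extHom (H : JetRing m Γ N R) :
    vder (extHom m Γ R N H) = extHom m Γ R N ∘ vder H := vder_map C ddComm_C H

theorem extHom_evol (W : Fin N → JetRing m Γ N R) (H : JetRing m Γ N R) :
    extHom m Γ R N (evol W H) = evol (extHom m Γ R N ∘ W) (extHom m Γ R N H) :=
  map_evol C ddComm_C W H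

omit [DDRing m Γ R] in
theorem extHom_comp_gen : extHom m Γ R N ∘ gen m Γ N R = gen m Γ N (JetRing m Γ N R) :=
  funext (map_gen C)

/-- To identify a functional derivative it suffices to pair it with all vectors over
`R[w][u]`. -/
theorem eq_of_cls_pair_extHom {K J : Fin N → JetRing m Γ N R}
    (h : ∀ W : Fin N → JetRing m Γ N (JetRing m Γ N R), cls m Γ (pair W (extHom m Γ R N ∘ K)) =
      cls m Γ (pair W (extHom m Γ R N ∘ J))) : K = J := by
  refine eq_of_cls_pair_map (m := m) (Γ := Γ) ?_
  have h' := h (C ∘ gen m Γ N R)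
  rwa [pair_comm _ (_ ∘ K), pair_comm _ (_ ∘ J)] at h'

/-- The three terms come from varying `δF/δu`, `δH/δu` and the coefficients of the operator in
`⟨B(δH/δu), δF/δu⟩`. -/
theorem vder_pencilBr (h : IsPencil L O P e) (H F : JetRing m Γ N R) :
    vder (pencilBr L O P e H F) = evol (pencil L O P e (gen m Γ N R) (vder H)) ∘ vder F -
      evol (pencil L O P e (gen m Γ N R) (vder F)) ∘ vder H +
        pencilAdj L O e (gen m Γ N R) (vder H) (vder F) := by
  refine eq_of_cls_pair_extHom fun W => ?_
  have hp : ∀ H : JetRing m Γ N R, extHom m Γ R N ∘ pencil L O P e (gen m Γ N R) (vder H) =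
      pencil L O P e (gen m Γ N _) (vder (extHom m Γ R N H)) := by
    intro H
    rw [map_pencil ddComm_extHom, extHom_comp_gen, vder_extHom]
  have hq : extHom m Γ R N ∘ pencilAdj L O e (gen m Γ N R) (vder H) (vder F) =
      pencilAdj L O e (gen m Γ N _) (vder (extHom m Γ R N H)) (vder (extHom m Γ R N F)) := by
    rw [map_pencilAdj ddComm_extHom, extHom_comp_gen, vder_extHom, vder_extHom]
  have hb : extHom m Γ R N (pencilBr L O P e H F) =
      pencilBr L O P e (extHom m Γ R N H) (extHom m Γ R N F) := by
    rw [pencilBr, bracketOf, extHom_evol, hp]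
    rfl
  have hd : ∀ H F : JetRing m Γ N R,
      extHom m Γ R N ∘ (evol (pencil L O P e (gen m Γ N R) (vder H)) ∘ vder F) =
        evol (pencil L O P e (gen m Γ N _) (vder (extHom m Γ R N H))) ∘
          vder (extHom m Γ R N F) := by
    intro H F
    rw [← hp, vder_extHom]
    exact funext fun i => extHom_evol _ _
  have hs : ∀ a b c : Fin N → JetRing m Γ N R, extHom m Γ R N ∘ (a - b + c) =
      extHom m Γ R N ∘ a - extHom m Γ R N ∘ b + extHom m Γ R N ∘ c := by
    intro a b c
    funext i
    simp
  rw [← vder_extHom, hb, cls_pair_vder_pencilBr h isDDExt_refl.jetRing, hs, hd, hd, hq]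

/-- By skew-symmetry the Jacobi identity is `X_{{H,F}} = [X_H, X_F]`, and both sides are evolution
derivations, so it is enough to compare them on the generators `u_i`. -/
theorem isPoisson_pencilBr (h : IsPencil L O P e) :
    IsPoisson (pencilBr L O P e : JetRing m Γ N R → JetRing m Γ N R → JetRing m Γ N R) := by
  have skew : ∀ H F : JetRing m Γ N R,
      cls m Γ (pencilBr L O P e H F) = -cls m Γ (pencilBr L O P e F H) := by
    intro H F
    rw [cls_pencilBr, cls_pencilBr, cls_pair_pencil_skew h isDDExt_refl.jetRing]
  refine ⟨fun H F => (sim_iff m Γ).2 (by rw [skew, map_neg]), fun H F G => (sim_iff m Γ).2 ?_⟩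
  have h1 : ∀ H F G : JetRing m Γ N R, cls m Γ (pencilBr L O P e (pencilBr L O P e F G) H) =
      -cls m Γ (evol (pencil L O P e (gen m Γ N R) (vder H))
        (evol (pencil L O P e (gen m Γ N R) (vder F)) G)) := fun H F G => skew _ _
  have h2 : cls m Γ (pencilBr L O P e (pencilBr L O P e G H) F) =
      cls m Γ (evol (pencil L O P e (gen m Γ N R) (vder F))
        (evol (pencil L O P e (gen m Γ N R) (vder H)) G)) := by
    have h3 : cls m Γ (pencilBr L O P e G H) = cls m Γ (-pencilBr L O P e H G) := by
      rw [skew, map_neg]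
    rw [skew]
    have h4 := (ddComm_evol (pencil L O P e (gen m Γ N R) (vder F))).cls_eq h3
    have h5 := congrArg Neg.neg h4
    rw [map_neg, map_neg, neg_neg] at h5
    exact h5
  have h3 : ∀ H F : JetRing m Γ N R, evol (pencil L O P e (gen m Γ N R) (vder H)) ∘
      pencil L O P e (gen m Γ N R) (vder F) =
        pencil L O P e (gen m Γ N R) (evol (pencil L O P e (gen m Γ N R) (vder H)) ∘ vder F) +
        pencilDeriv L O e (gen m Γ N R) (pencil L O P e (gen m Γ N R) (vder H)) (vder F) := by
    intro H F
    rw [(ddDer_evol _).map_pencil, evol_comp_gen]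
  rw [map_add, map_add, h1 H F G, h2, map_zero]
  -- `X_{{H,F}}` and `[X_H, X_F]` agree on the generators
  have h4 : pencil L O P e (gen m Γ N R) (vder (pencilBr L O P e H F)) =
      evol (pencil L O P e (gen m Γ N R) (vder H)) ∘ pencil L O P e (gen m Γ N R) (vder F) -
      evol (pencil L O P e (gen m Γ N R) (vder F)) ∘ pencil L O P e (gen m Γ N R) (vder H) := by
    rw [h3, h3, vder_pencilBr h, pencil_add, pencil_sub, pencil_pencilAdj h isDDExt_refl.jetRing]
    abel
  rw [pencilBr, bracketOf, h4, ← evol_commutator, map_sub]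
  abel

end Jacobi
end Pencil

/-! ### Naturality -/

section Composition

variable {m : ℕ} {Γ : Type*} [Group Γ] {R : Type*} [CommRing R] [DDRing m Γ R] {N M : ℕ}

variable (m Γ R N) in
/-- The linear forms in the variables `u_i^{(g|σ)}`: the values of operators at the generic
point. -/
noncomputable def linForms : Submodule R (JetRing m Γ N R) := Submodule.span R (Set.range X)

theorem d_mem_linForms (l : Fin m) {f : JetRing m Γ N R} (hf : f ∈ linForms m Γ R N) :
    (DDRing.d Γ l : JetRing m Γ N R →+ JetRing m Γ N R) f ∈ linForms m Γ R N := by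
  induction hf using Submodule.span_induction with
  | mem x hx =>
    obtain ⟨v, rfl⟩ := hx
    rw [d_X]
    exact Submodule.subset_span ⟨_, rfl⟩
  | zero => simp
  | add x y _ _ hx hy => rw [map_add]; exact add_mem hx hy
  | smul r x hx' hx =>
    rw [smul_eq_C_mul, DDRing.d_mul, d_C, ← smul_eq_C_mul, ← smul_eq_C_mul]
    exact add_mem (Submodule.smul_mem _ _ hx) (Submodule.smul_mem _ _ hx')

theorem shift_mem_linForms (g : Γ) {f : JetRing m Γ N R} (hf : f ∈ linForms m Γ R N) :
    (DDRing.shift m g : RingAut (JetRing m Γ N R)) f ∈ linForms m Γ R N := by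
  induction hf using Submodule.span_induction with
  | mem x hx =>
    obtain ⟨v, rfl⟩ := hx
    rw [shift_X]
    exact Submodule.subset_span ⟨_, rfl⟩
  | zero => simp
  | add x y _ _ hx hy => rw [map_add]; exact add_mem hx hy
  | smul r x hx' hx =>
    rw [smul_eq_C_mul, map_mul, shift_C, ← smul_eq_C_mul]
    exact Submodule.smul_mem _ _ hx

theorem dpow_mem_linForms (σ : Fin m → ℕ) {f : JetRing m Γ N R} (hf : f ∈ linForms m Γ R N) :
    dpow m Γ σ f ∈ linForms m Γ R N := by
  unfold dpow
  induction List.finRange m with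
  | nil => exact hf
  | cons l s ih =>
    rw [List.foldr_cons]
    induction σ l with
    | zero => exact ih
    | succ k ih' => rw [Function.iterate_succ_apply']; exact d_mem_linForms l ih'

theorem jet_mem_linForms (p : JetIndex m Γ) {f : JetRing m Γ N R} (hf : f ∈ linForms m Γ R N) :
    jet m Γ p f ∈ linForms m Γ R N := shift_mem_linForms _ (dpow_mem_linForms _ hf)

theorem jetAdj_mem_linForms (p : JetIndex m Γ) {f : JetRing m Γ N R}
    (hf : f ∈ linForms m Γ R N) : jetAdj m Γ p f ∈ linForms m Γ R N := by
  rw [jetAdj, neg_one_pow_mul_eq_zsmul]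
  exact zsmul_mem (dpow_mem_linForms _ (shift_mem_linForms _ hf)) _

omit [DDRing m Γ R] in
theorem gen_mem_linForms (i : Fin N) : gen m Γ N R i ∈ linForms m Γ R N :=
  Submodule.subset_span ⟨_, rfl⟩

theorem app_mem_linForms {M' : ℕ} (P : DDOp m Γ R M' M) {x : Fin M → JetRing m Γ N R}
    (hx : ∀ i, x i ∈ linForms m Γ R N) (k : Fin M') : P.app x k ∈ linForms m Γ R N := by
  refine sum_mem fun i _ => sum_mem fun p _ => ?_
  simp only [← Algebra.smul_def]
  exact Submodule.smul_mem _ _ (jet_mem_linForms p (hx i))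

theorem adj_mem_linForms {M' : ℕ} (P : DDOp m Γ R M' M) {x : Fin M' → JetRing m Γ N R}
    (hx : ∀ i, x i ∈ linForms m Γ R N) (k : Fin M) : P.adj x k ∈ linForms m Γ R N := by
  refine sum_mem fun i _ => sum_mem fun p _ => ?_
  simp only [← Algebra.smul_def]
  exact jetAdj_mem_linForms p (Submodule.smul_mem _ _ (hx i))

omit [DDRing m Γ R] in
/-- A vector of linear forms is the value of an operator at the generic point, and this operator
acts by evaluation of the forms. -/
theorem exists_app_eq_evalJet {K : Fin M → JetRing m Γ N R}
    (hK : ∀ k, K k ∈ linForms m Γ R N) :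
    ∃ Q : DDOp m Γ R M N, ∀ (T : Type w) [CommRing T] [Algebra R T] [DDRing m Γ T]
      (U : Fin N → T), Q.app U = evalJet U ∘ K := by
  have key : ∀ f ∈ linForms m Γ R N, ∃ q : Fin N → (JetIndex m Γ →₀ R),
      ∀ (T : Type w) [CommRing T] [Algebra R T] [DDRing m Γ T] (U : Fin N → T),
        ∑ i, (q i).sum (fun p a => algebraMap R T a * jet m Γ p (U i)) = evalJet U f := by
    intro f hf
    induction hf using Submodule.span_induction with
    | mem x hx =>
      obtain ⟨v, rfl⟩ := hx
      refine ⟨Pi.single v.1 (Finsupp.single v.2 1), fun T _ _ _ U => ?_⟩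
      rw [Finset.sum_eq_single v.1]
      · simp
      · intro i _ hi
        simp [hi]
      · simp
    | zero => exact ⟨0, fun T _ _ _ U => by simp⟩
    | add x y _ _ hx hy =>
      obtain ⟨q, hq⟩ := hx
      obtain ⟨r, hr⟩ := hy
      refine ⟨q + r, fun T _ _ _ U => ?_⟩
      rw [map_add, ← hq, ← hr, ← Finset.sum_add_distrib]
      refine Finset.sum_congr rfl fun i _ => ?_
      rw [Pi.add_apply, Finsupp.sum_add_index'] <;> simp [add_mul]
    | smul r x _ hx =>
      obtain ⟨q, hq⟩ := hx
      refine ⟨r • q, fun T _ _ _ U => ?_⟩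
      rw [map_smul, ← hq, Finset.smul_sum]
      refine Finset.sum_congr rfl fun i _ => ?_
      rw [Pi.smul_apply, Finsupp.sum_smul_index (by simp), Finsupp.smul_sum]
      simp [Algebra.smul_def, mul_assoc]
  choose q hq using fun k => key (K k) (hK k)
  exact ⟨q, fun T _ _ _ U => funext fun k => hq k T U⟩

end Composition

section Naturality

variable {m : ℕ} {Γ : Type v} [Group Γ] {R : Type u} [CommRing R] [DDRing m Γ R] {N M : ℕ}
  {L : DDLie.{u, v} m Γ R N} {L' : DDLie.{u, v} m Γ R M} {O : DDOp m Γ R N N} {φ : DDOp m Γ R M N}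

/-- The composition `φ O φ†` is again an operator. -/
theorem exists_app_eq_conj (O : DDOp m Γ R N N) (φ : DDOp m Γ R M N) :
    ∃ O' : DDOp m Γ R M M, ∀ (S : Type (max u v)) [CommRing S] [Algebra R S] [DDRing m Γ S],
      IsDDExt m Γ R S → ∀ U : Fin M → S, O'.app U = φ.app (O.app (φ.adj U)) := by
  obtain ⟨Q, hQ⟩ := exists_app_eq_evalJet.{max u v} (m := m) (Γ := Γ) (R := R) (N := M)
    (K := φ.app (O.app (φ.adj (gen m Γ M R))))
    (app_mem_linForms φ (app_mem_linForms O (adj_mem_linForms φ gen_mem_linForms)))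
  refine ⟨Q, fun S _ _ _ hS U => ?_⟩
  have h := (ddComm_evalJet hS.ddComm U).ddLin_algHom
  rw [hQ, h.map_app, h.map_app, h.map_adj, evalJet_comp_gen]

/-- The dual of a homomorphism of Lie algebras intertwines the coadjoint actions. -/
theorem IsLieHom.adj_coad (hφ : IsLieHom L L' φ) {S : Type (max u v)} [CommRing S] [Algebra R S]
    [DDRing m Γ S] (hS : IsDDExt m Γ R S) (x : Fin N → S) (V : Fin M → S) :
    φ.adj (L'.coad (φ.app x) V) = L.coad x (φ.adj V) := by
  refine eq_of_cls_pair_C (m := m) (Γ := Γ) fun y => ?_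
  have hC : DDLin m Γ R (C : S → JetRing m Γ N S) :=
    DDComm.ddLin_algHom (f := IsScalarTower.toAlgHom R S (JetRing m Γ N S)) ddComm_C
  rw [C_comp_coad, hC.map_adj, hC.map_adj, ← cls_pair_app, C_comp_coad, hC.map_app,
    L'.cls_pair_coad, L.cls_pair_coad, ← hφ _ hS.jetRing, cls_pair_app]

theorem IsLieHom.isOOperator (hφ : IsLieHom L L' φ) (hO : IsOOperator L O) {O' : DDOp m Γ R M M}
    (hO' : ∀ (S : Type (max u v)) [CommRing S] [Algebra R S] [DDRing m Γ S], IsDDExt m Γ R S →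
      ∀ U : Fin M → S, O'.app U = φ.app (O.app (φ.adj U))) : IsOOperator L' O' where
  skew S _ _ _ hS U V := by
    rw [sim_iff, hO' S hS, hO' S hS, map_neg, cls_pair_app φ, cls_pair_app φ,
      (sim_iff m Γ).1 (hO.skew S hS _ _), map_neg]
  hom S _ _ _ hS U V := by
    rw [hO' S hS, hO' S hS, hO' S hS, ← hφ S hS, ← hO.hom S hS]
    simp only [DDLie.dualBrac, hO' S hS, DDOp.adj_sub, hφ.adj_coad hS]

/-- The chain rule `δ(Φ H)/δq = φ(Φ(δH/δu))` for `Φ(u) = φ†(q)`. -/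
theorem vder_dualMap (φ : DDOp m Γ R M N) (H : JetRing m Γ N R) :
    vder (dualMap φ H) = φ.app (dualMap φ ∘ vder H) := by
  refine eq_of_cls_pair_extHom fun W => ?_
  let S := JetRing m Γ M R
  have hx := (ddComm_extHom (m := m) (Γ := Γ) (R := R) (N := M)).ddLin_algHom
  -- the extension of `Φ` to the coefficients `R[w]`
  let Ψ : JetRing m Γ N S →ₐ[S] JetRing m Γ M S := evalJet (φ.adj (gen m Γ M S))
  have hΨ : ∀ H : JetRing m Γ N R, extHom m Γ R M (dualMap φ H) = Ψ (map C H) := by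
    intro H
    induction H using MvPolynomial.induction_on with
    | C a => simp [dualMap, Ψ, extHom]
    | add p q hp hq => simp only [map_add, hp, hq]
    | mul_X p v hp =>
      rw [map_mul, map_mul, hp, map_mul, map_mul, map_X]
      congr 1
      have h := congrFun (hx.map_adj φ (gen m Γ M R)) v.1
      rw [extHom_comp_gen] at h
      simp only [dualMap, aeval_X, Ψ, evalJet_X]
      rw [ddComm_extHom.map_jet, ← h]
      rfl
  have hΨ' : extHom m Γ R M ∘ (dualMap φ ∘ vder H) = Ψ ∘ vder (map C H : JetRing m Γ N S) := by
    rw [vder_map C ddComm_C]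
    exact funext fun i => hΨ _
  have hW : DDDer m Γ R (evol W) := ddDer_evol W
  rw [hx.map_app, hΨ', cls_pair_app, ← vder_extHom, ← cls_evol, hΨ,
    cls_derivation_evalJet ddComm_C (evol W) (ddComm_evol W), hW.ddLin.map_adj, evol_comp_gen]

/-- An evaluation homomorphism intertwines two evolution derivations as soon as it does so on the
generators `u_i`. -/
theorem evalJet_evol {A : Type*} [CommRing A] [DDRing m Γ A] {U : Fin N → JetRing m Γ M A}
    {W : Fin N → JetRing m Γ N A} {V : Fin M → JetRing m Γ M A}
    (h : evalJet U ∘ W = evol V ∘ U) (F : JetRing m Γ N A) :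
    evalJet U (evol W F) = evol V (evalJet U F) := by
  induction F using MvPolynomial.induction_on with
  | C a => simp [← algebraMap_eq]
  | add p q hp hq => simp only [map_add, hp, hq]
  | mul_X p v hp =>
    have h1 : evalJet U (W v.1) = evol V (U v.1) := congrFun h v.1
    simp only [Derivation.leibniz, map_add, map_mul, smul_eq_mul, hp, evol_X, evalJet_X,
      (ddComm_evol V).map_jet, (ddComm_evalJet ddComm_C U).map_jet, h1]

/-- Both sides apply an evolution derivation, so only the generators matter; there the identity is
`φ†(O_ℋ(φ(Y).q).q) = O(Y.φ†(q)).φ†(q)`. -/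
theorem IsLieHom.dualMap_quadBr (hφ : IsLieHom L L' φ) {O' : DDOp m Γ R M M}
    (hO' : ∀ (S : Type (max u v)) [CommRing S] [Algebra R S] [DDRing m Γ S], IsDDExt m Γ R S →
      ∀ U : Fin M → S, O'.app U = φ.app (O.app (φ.adj U))) (H F : JetRing m Γ N R) :
    dualMap φ (quadBr L O H F) = quadBr L' O' (dualMap φ H) (dualMap φ F) := by
  have hR : IsDDExt m Γ R (JetRing m Γ M R) := isDDExt_refl.jetRing
  refine evalJet_evol (U := φ.adj (gen m Γ M R)) ?_ F
  have hΦ : DDComm m Γ (evalJet (φ.adj (gen m Γ M R)) : JetRing m Γ N R →ₐ[R] JetRing m Γ M R) :=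
    ddComm_evalJet ddComm_C _
  have hc : ∀ x U : Fin N → JetRing m Γ N R, evalJet (φ.adj (gen m Γ M R)) ∘ L.coad x U =
      L.coad (evalJet (φ.adj (gen m Γ M R)) ∘ x) (evalJet (φ.adj (gen m Γ M R)) ∘ U) := fun x U =>
    L.map_coad hΦ x U
  rw [(ddDer_evol (R := R) _).ddLin.map_adj, hc, hΦ.ddLin_algHom.map_app, hc, evalJet_comp_gen,
    evol_comp_gen, vder_dualMap]
  change _ = φ.adj (L'.coad (O'.app (L'.coad (φ.app (dualMap φ ∘ vder H)) (gen m Γ M R)))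
    (gen m Γ M R))
  rw [hO' _ hR, hφ.adj_coad hR, hφ.adj_coad hR]
  rfl

end Naturality

/-! ### The three brackets and the Hamiltonian action -/

section Brackets

variable {m : ℕ} {Γ : Type v} [Group Γ] {R : Type u} [CommRing R] [DDRing m Γ R] {N : ℕ}
  {L : DDLie.{u, v} m Γ R N} {O P : DDOp m Γ R N N}

theorem IsConst.evol_smul {c : R} (hc : IsConst m Γ c) (W : Fin N → JetRing m Γ N R)
    (F : JetRing m Γ N R) :
    evol ((C c : JetRing m Γ N R) • W) F = C c * evol W F := by
  have h : evol ((C c : JetRing m Γ N R) • W) = (C c : JetRing m Γ N R) • evol W :=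
    derivation_ext fun v => by
      have h1 := (isConst_C (N := N) hc).ddLin (R := R)
      simp only [evol_X, Derivation.smul_apply, Pi.smul_apply, smul_eq_mul, ← h1.map_jet]
  rw [h]
  rfl

/-- The bracket of the pencil is the linear combination of the three basic brackets. -/
theorem pencilBr_eq {e : Fin 3 → R} (he : ∀ j, IsConst m Γ (e j)) (H F : JetRing m Γ N R) :
    pencilBr L O P e H F = C (e 0) * bracketOf P.app H F + C (e 1) * linBr L H F +
      C (e 2) * quadBr L O H F := by
  have h : pencil L O P e (gen m Γ N R) (vder H) =
      (C (e 0) : JetRing m Γ N R) • P.app (vder H) +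
        (C (e 1) : JetRing m Γ N R) • (-L.coad (vder H) (gen m Γ N R)) +
        (C (e 2) : JetRing m Γ N R) •
          L.coad (O.app (L.coad (vder H) (gen m Γ N R))) (gen m Γ N R) := by
    rw [smul_neg, ← sub_eq_add_neg]
    rfl
  simp only [pencilBr, linBr, quadBr, bracketOf]
  rw [h, evol_add, evol_add, ← (he 0).evol_smul, ← (he 1).evol_smul, ← (he 2).evol_smul]
  rfl

theorem isConst_zero : IsConst m Γ (0 : R) := ⟨fun _ => map_zero _, fun _ => map_zero _⟩

theorem isConst_one : IsConst m Γ (1 : R) := by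
  refine ⟨fun l => ?_, fun g => map_one _⟩
  simpa using DDRing.d_mul (Γ := Γ) l (1 : R) 1

theorem IsConst.mul {a b : R} (ha : IsConst m Γ a) (hb : IsConst m Γ b) : IsConst m Γ (a * b) :=
  ⟨fun l => by rw [DDRing.d_mul, ha.1, hb.1]; simp, fun g => by rw [map_mul, ha.2, hb.2]⟩

/-- Without the constant-coefficient term the pencil needs no further condition on `O`. -/
theorem IsOOperator.isPencil (hO : IsOOperator L O) {a b : R} (ha : IsConst m Γ a)
    (hb : IsConst m Γ b) : IsPencil L O 0 ![0, a, b] := by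
  have h0 : ∀ (S : Type (max u v)) [CommRing S] [Algebra R S] [DDRing m Γ S] (x : Fin N → S),
      (0 : DDOp m Γ R N N).app x = 0 := by
    intro S _ _ _ x
    funext k
    simp [DDOp.app]
  have h0' : ∀ (S : Type (max u v)) [CommRing S] [Algebra R S] [DDRing m Γ S] (x : Fin N → S),
      L.coad x (0 : Fin N → S) = 0 := by
    intro S _ _ _ x
    simpa using L.coad_add_right x 0 0
  refine ⟨hO, ?_, ?_, ?_, ?_, ?_⟩
  · intro j
    fin_cases j
    exacts [isConst_zero, ha, hb]
  · intro S _ _ _ _ x y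
    rw [sim_iff, h0, h0]
    simp [pair]
  · intro S _ _ _ _ x y
    rw [h0, h0, h0, h0', h0', sub_zero]
  · intro S _ _ _ _ x
    simp
  · intro S _ _ _ _ x
    simp

/-- The inverse of a skew-symmetric `O`-operator is a skew-symmetric one-cocycle. -/
theorem IsInverseOp.isPencil (hP : IsInverseOp O P) (hO : IsOOperator L O) {a b c : R}
    (ha : IsConst m Γ a) (hb : IsConst m Γ b) (hc : IsConst m Γ c) :
    IsPencil L O P ![a, b, c] := by
  refine ⟨hO, ?_, ?_, ?_, ?_, ?_⟩
  · intro j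
    fin_cases j
    exacts [ha, hb, hc]
  · intro S _ _ _ hS x y
    have h := hO.skew S hS (P.app x) (P.app y)
    rwa [hP.right_inv S hS, hP.right_inv S hS] at h
  · intro S _ _ _ hS x y
    have h := hO.hom S hS (P.app x) (P.app y)
    rw [hP.right_inv S hS, hP.right_inv S hS] at h
    rw [← h, hP.left_inv S hS, DDLie.dualBrac, hP.right_inv S hS, hP.right_inv S hS]
  · intro S _ _ _ hS x
    rw [hP.right_inv S hS]
  · intro S _ _ _ hS x
    rw [hP.left_inv S hS]

theorem constBr_eq {ε : R} (hε : IsConst m Γ ε) (P : DDOp m Γ R N N) (H F : JetRing m Γ N R) :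
    constBr ε P H F = C ε * bracketOf P.app H F := hε.evol_smul _ F

theorem IsOOperator.isPoisson_quadBr (hO : IsOOperator L O) : IsPoisson (quadBr L O) := by
  have h := hO.isPencil isConst_zero isConst_one
  have h' := isPoisson_pencilBr h
  have he : (pencilBr L O 0 ![0, 0, 1] : JetRing m Γ N R → JetRing m Γ N R → JetRing m Γ N R) =
      quadBr L O := by
    funext H F
    rw [pencilBr_eq h.const]
    simp
  rwa [he] at h'

theorem IsOOperator.compatible (hO : IsOOperator L O) : Compatible ![linBr L, quadBr L O] := by
  intro a ha
  have h := hO.isPencil (ha 0) (ha 1)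
  convert isPoisson_pencilBr h using 3 with H F
  rw [pencilBr_eq h.const]
  simp

theorem IsInverseOp.compatible (hP : IsInverseOp O P) (hO : IsOOperator L O) {ε : R}
    (hε : IsConst m Γ ε) : Compatible ![constBr ε P, linBr L, quadBr L O] := by
  intro a ha
  have h := hP.isPencil hO ((ha 0).mul hε) (ha 1) (ha 2)
  convert isPoisson_pencilBr h using 3 with H F
  rw [pencilBr_eq h.const]
  simp [Fin.sum_univ_three, constBr_eq hε, mul_assoc]

theorem IsOOperator.cls_quadBr (hO : IsOOperator L O) (H F : JetRing m Γ N R) :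
    cls m Γ (quadBr L O H F) = cls m Γ
      (pair (L.coad (vder H) (gen m Γ N R)) (O.app (L.coad (vder F) (gen m Γ N R)))) := by
  rw [quadBr, bracketOf, cls_evol, hO.cls_pair_coad isDDExt_refl.jetRing]

end Brackets

section HamiltonianAction

variable {m : ℕ} {Γ : Type v} [Group Γ] {R : Type u} [CommRing R] [DDRing m Γ R] {N : ℕ}
  (L : DDLie.{u, v} m Γ R N) {O : DDOp m Γ R N N}

variable {S : Type (max u v)} [CommRing S] [Algebra R S] [DDRing m Γ S]

/-- `X^∧(H) ∼ ⟨-(δH/δu).u, X⟩`. -/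
theorem DDLie.cls_hat (hS : IsDDExt m Γ R S) (X : Fin N → S) (H : JetRing m Γ N S) :
    cls m Γ (L.hat X H) =
      cls m Γ (pair (-L.coad (vder H) (gen m Γ N S)) (C ∘ X)) := by
  rw [DDLie.hat, cls_evol, L.cls_pair_coad' hS.jetRing, pair_neg_left, map_neg]
  rfl

/-- `H^∼ = -(δH/δu).u`. -/
theorem isTilde_neg_coad_vder (H : JetRing m Γ N R) :
    IsTilde L H (-L.coad (vder H) (gen m Γ N R)) := by
  intro S _ _ _ hS X
  have hm := ddComm_map (N := N) (algebraMap R S) hS.ddComm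
  have h : map (algebraMap R S) ∘ (-L.coad (vder H) (gen m Γ N R)) =
      -L.coad (vder (map (algebraMap R S) H)) (gen m Γ N S) := by
    have h1 := L.map_coad (f := mapAlgHom (Algebra.ofId R S)) hm (vder H) (gen m Γ N R)
    have h2 : map (algebraMap R S) ∘ gen m Γ N R = gen m Γ N S := _root_.funext (map_gen _)
    rw [vder_map _ hS.ddComm, ← h2]
    funext i
    have h3 := congrFun h1 i
    simp only [Function.comp_apply, Pi.neg_apply, map_neg] at h3 ⊢
    exact congrArg Neg.neg h3
  rw [sim_iff, L.cls_hat hS]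
  change cls m Γ (pair (map (algebraMap R S) ∘ _) (C ∘ X)) = _
  rw [h]

theorem IsTilde.unique {H : JetRing m Γ N R} {K J : Fin N → JetRing m Γ N R}
    (hK : IsTilde L H K) (hJ : IsTilde L H J) : K = J := by
  refine eq_of_cls_pair_map (m := m) (Γ := Γ) ?_
  have hS : IsDDExt m Γ R (JetRing m Γ N R) := isDDExt_refl.jetRing
  exact ((sim_iff m Γ).1 (hK _ hS (gen m Γ N R))).trans
    ((sim_iff m Γ).1 (hJ _ hS (gen m Γ N R))).symm

theorem DDLie.hat_comp_coad {S : Type w} [CommRing S] [Algebra R S] [DDRing m Γ S]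
    (X : Fin N → S) (Y : Fin N → JetRing m Γ N S) :
    L.hat X ∘ L.coad Y (gen m Γ N S) =
      L.coad (L.hat X ∘ Y) (gen m Γ N S) + L.coad Y (L.coad (C ∘ X) (gen m Γ N S)) := by
  have h : DDDer m Γ R (L.hat X) := ddDer_evol _
  have h1 := L.derivation_coad h Y (gen m Γ N S)
  have h2 : L.hat X ∘ gen m Γ N S = L.coad (C ∘ X) (gen m Γ N S) := evol_comp_gen _
  rw [h2] at h1
  exact h1

end HamiltonianAction

section Criterion

variable {m : ℕ} {Γ : Type v} [Group Γ] {R : Type u} [CommRing R] [DDRing m Γ R] {N : ℕ}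
  (L : DDLie.{u, v} m Γ R N) {O : DDOp m Γ R N N}

/-- `δ(X^∧ H)/δu`, computed by commuting `X^∧` with the evolution derivation of an arbitrary
vector. -/
theorem DDLie.cls_pair_vder_hat {S : Type (max u v)} [CommRing S] [Algebra R S] [DDRing m Γ S]
    (X : Fin N → S) (H : JetRing m Γ N S)
    (W : Fin N → JetRing m Γ N S) :
    cls m Γ (pair W (vder (L.hat X H))) =
      cls m Γ (pair W (L.hat X ∘ vder H - L.brac (C ∘ X) (vder H))) := by
  have hW : DDDer m Γ R (evol W) := ddDer_evol W
  have hX : DDDer m Γ S (L.hat X) := ddDer_evol _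
  have h1 : evol W ∘ L.coad (C ∘ X) (gen m Γ N S) = L.coad (C ∘ X) W := by
    have h := L.derivation_coad hW (C ∘ X) (gen m Γ N S)
    have h0 : evol W ∘ (C ∘ X : Fin N → JetRing m Γ N S) = 0 := by
      funext i
      simp
    rw [evol_comp_gen, h0] at h
    have h2 : L.coad (0 : Fin N → JetRing m Γ N S) (gen m Γ N S) = 0 := by
      simpa using L.coad_add_left 0 0 (gen m Γ N S)
    rw [h2, zero_add] at h
    exact h
  have h2 := evol_commutator W (L.coad (C ∘ X) (gen m Γ N S)) H
  rw [h1, sub_eq_iff_eq_add] at h2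
  rw [← cls_evol]
  change cls m Γ (evol W (evol (L.coad (C ∘ X) (gen m Γ N S)) H)) = _
  rw [h2]
  change cls m Γ (evol (L.coad (C ∘ X) W - L.hat X ∘ W) H + L.hat X (evol W H)) = _
  rw [map_add, cls_evol, hX.cls_eq (cls_evol W H), hX.map_pair, pair_sub_left, map_sub,
    map_add, L.cls_pair_coad, pair_sub_right, map_sub]
  abel

theorem DDLie.vder_hat (X : Fin N → R) (H : JetRing m Γ N R) :
    vder (L.hat X H) = L.hat X ∘ vder H - L.brac (C ∘ X) (vder H) := by
  refine eq_of_cls_pair_extHom fun W => ?_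
  have hh : ∀ F : JetRing m Γ N R, extHom m Γ R N (L.hat X F) =
      L.hat (C ∘ X : Fin N → JetRing m Γ N R) (extHom m Γ R N F) := by
    intro F
    have h := L.map_coad (ddComm_extHom (m := m) (Γ := Γ) (R := R) (N := N))
      (C ∘ X) (gen m Γ N R)
    have h0 : extHom m Γ R N ∘ (C ∘ X) = C ∘ (C ∘ X) := by
      funext i
      simp [extHom]
    rw [extHom_comp_gen, h0] at h
    have h1 := extHom_evol (L.coad (C ∘ X) (gen m Γ N R)) F
    rw [h] at h1
    exact h1
  have hd : extHom m Γ R N ∘ (L.hat X ∘ vder H - L.brac (C ∘ X) (vder H)) =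
      L.hat (C ∘ X : Fin N → JetRing m Γ N R) ∘ vder (extHom m Γ R N H) -
        L.brac (C ∘ (C ∘ X)) (vder (extHom m Γ R N H)) := by
    have h := L.map_brac (ddComm_extHom (m := m) (Γ := Γ) (R := R) (N := N))
      (C ∘ X) (vder H)
    have h0 : extHom m Γ R N ∘ (C ∘ X) = C ∘ (C ∘ X) := by
      funext i
      simp [extHom]
    rw [h0] at h
    rw [vder_extHom]
    funext i
    have h' := congrFun h i
    simp only [Function.comp_apply, Pi.sub_apply, map_sub, hh] at h' ⊢
    rw [← h']
  rw [← vder_extHom, hh, L.cls_pair_vder_hat, hd]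

/-- In terms of `H^∼ = -(δH/δu).u`, this is `(X^∧ H)^∼ = X^∧(H^∼) - X.H^∼`. -/
theorem DDLie.coad_vder_hat (X : Fin N → R) (H : JetRing m Γ N R) :
    L.coad (vder (L.hat X H)) (gen m Γ N R) =
      L.hat X ∘ L.coad (vder H) (gen m Γ N R) -
        L.coad (C ∘ X) (L.coad (vder H) (gen m Γ N R)) := by
  have hR : IsDDExt m Γ R (JetRing m Γ N R) := isDDExt_refl.jetRing
  rw [L.vder_hat, L.coad_sub_left, L.coad_brac hR, L.hat_comp_coad]
  abel

/-- The terms with `X^∧(H^∼)` and `X^∧(F^∼)` cancel; what is left are the coadjoint terms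
`⟨X.H^∼, O(F^∼)⟩ - ⟨X.F^∼, O(H^∼)⟩`. -/
theorem IsOOperator.cls_hat_quadBr (hO : IsOOperator L O) (X : Fin N → R) (H F : JetRing m Γ N R) :
    cls m Γ (L.hat X (quadBr L O H F) - quadBr L O (L.hat X H) F - quadBr L O H (L.hat X F)) =
      cls m Γ (pair (L.dualBrac O (L.coad (vder H) (gen m Γ N R)) (L.coad (vder F) (gen m Γ N R)))
        (C ∘ X)) := by
  have hR : IsDDExt m Γ R (JetRing m Γ N R) := isDDExt_refl.jetRing
  have hX : DDDer m Γ R (L.hat X) := ddDer_evol _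
  rw [map_sub, map_sub, hX.cls_eq (hO.cls_quadBr H F), hX.map_pair, hX.ddLin.map_app,
    hO.cls_quadBr, hO.cls_quadBr, L.coad_vder_hat, L.coad_vder_hat, DDLie.dualBrac]
  simp only [DDOp.app_sub, pair_sub_left, pair_sub_right, map_sub, map_add]
  rw [(sim_iff m Γ).1 (hO.skew _ hR _ (L.coad (C ∘ X) _)), map_neg,
    L.cls_pair_coad' hR (C ∘ X), L.cls_pair_coad' hR (C ∘ X)]
  abel

theorem DDLie.dualBrac_neg_neg {T : Type w} [CommRing T] [Algebra R T] [DDRing m Γ T]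
    (U V : Fin N → T) : L.dualBrac O (-U) (-V) = L.dualBrac O U V := by
  simp only [DDLie.dualBrac, DDOp.app_neg, L.coad_neg_left, L.coad_neg_right, neg_neg]

theorem DDLie.hat_commutator (X Y : Fin N → R) (H : JetRing m Γ N R) :
    L.hat X (L.hat Y H) - L.hat Y (L.hat X H) = -L.hat (L.brac X Y) H := by
  have hR : IsDDExt m Γ R (JetRing m Γ N R) := isDDExt_refl.jetRing
  have h0 : ∀ X Y : Fin N → R, L.hat X ∘ (C ∘ Y : Fin N → JetRing m Γ N R) = 0 := by
    intro X Y
    funext i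
    simp [DDLie.hat]
  have h1 : L.coad (0 : Fin N → JetRing m Γ N R) (gen m Γ N R) = 0 := by
    simpa using L.coad_add_left 0 0 (gen m Γ N R)
  have h2 : (C ∘ L.brac X Y : Fin N → JetRing m Γ N R) = L.brac (C ∘ X) (C ∘ Y) :=
    L.map_brac (f := Algebra.ofId R (JetRing m Γ N R)) ddComm_C X Y
  have h3 : L.hat X ∘ L.coad (C ∘ Y) (gen m Γ N R) - L.hat Y ∘ L.coad (C ∘ X) (gen m Γ N R) =
      -L.coad (C ∘ L.brac X Y) (gen m Γ N R) := by
    rw [L.hat_comp_coad, L.hat_comp_coad, h0, h0, h1, h2, L.coad_brac hR]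
    abel
  have h4 := evol_commutator (L.coad (C ∘ X) (gen m Γ N R)) (L.coad (C ∘ Y) (gen m Γ N R)) H
  change L.hat X (L.hat Y H) - L.hat Y (L.hat X H) =
    evol (L.hat X ∘ L.coad (C ∘ Y) (gen m Γ N R) - L.hat Y ∘ L.coad (C ∘ X) (gen m Γ N R)) H at h4
  rw [h4, h3, evol_neg]
  rfl

end Criterion

end DiffDiff

theorem mainTheorem1 {m N : ℕ} {Γ : Type v} [Group Γ] {R : Type u} [CommRing R] [DDRing m Γ R]
    (L : DDLie.{u, v} m Γ R N) (O : DDOp m Γ R N N) (hO : IsOOperator L O) :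
    -- the formulas for the quadratic bracket
    (∀ H F : JetRing m Γ N R,
      Sim m Γ (quadBr L O H F)
        (pair (L.coad (vder H) (gen m Γ N R)) (O.app (L.coad (vder F) (gen m Γ N R)))) ∧
      Sim m Γ (quadBr L O H F)
        (-pair (L.coad (vder F) (gen m Γ N R)) (O.app (L.coad (vder H) (gen m Γ N R)))) ∧
      Sim m Γ (quadBr L O H F)
        (pair (L.coad (O.app (L.coad (vder H) (gen m Γ N R))) (gen m Γ N R)) (vder F))) ∧
    -- the quadratic bracket is a Poisson bracket
    IsPoisson (quadBr L O) ∧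
    -- it is compatible with the linear one
    Compatible ![linBr L, quadBr L O] ∧
    -- for invertible `O`: all three brackets are compatible
    (∀ P : DDOp m Γ R N N, IsInverseOp O P → ∀ ε : R, IsConst m Γ ε →
      Compatible ![constBr ε P, linBr L, quadBr L O]) ∧
    -- naturality
    (∀ (M : ℕ) (L' : DDLie.{u, v} m Γ R M) (φ : DDOp m Γ R M N), IsLieHom L L' φ →
      ∃ O' : DDOp m Γ R M M,
        (∀ (S : Type (max u v)) [CommRing S] [Algebra R S] [DDRing m Γ S], IsDDExt m Γ R S →
          ∀ U : Fin M → S, O'.app U = φ.app (O.app (φ.adj U))) ∧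
        IsOOperator L' O' ∧
        ∀ H F : JetRing m Γ N R,
          dualMap φ (quadBr L O H F) = quadBr L' O' (dualMap φ H) (dualMap φ F)) ∧
    -- the coadjoint action is an antirepresentation by evolution derivations
    (∀ X Y : Fin N → R, ⁅(L.hat X : Derivation R (JetRing m Γ N R) (JetRing m Γ N R)), L.hat Y⁆ =
      -L.hat (L.brac X Y)) ∧
    -- the infinitesimal Hamiltonian action criterion
    (∀ H : JetRing m Γ N R, ∃! K : Fin N → JetRing m Γ N R, IsTilde L H K) ∧
    (∀ (H F : JetRing m Γ N R) (K J : Fin N → JetRing m Γ N R), IsTilde L H K → IsTilde L F J →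
      ∀ X : Fin N → R,
        Sim m Γ
          (L.hat X (quadBr L O H F) - quadBr L O (L.hat X H) F - quadBr L O H (L.hat X F))
          (pair (L.dualBrac O K J) fun i => MvPolynomial.C (X i))) := by
  have hR : IsDDExt m Γ R (JetRing m Γ N R) := isDDExt_refl.jetRing
  refine ⟨fun H F => ⟨?_, ?_, ?_⟩, hO.isPoisson_quadBr, hO.compatible,
    fun P hP ε hε => hP.compatible hO hε, fun M L' φ hφ => ?_, fun X Y => ?_, fun H => ?_, ?_⟩
  · rw [sim_iff, hO.cls_quadBr]
  · rw [sim_iff, hO.cls_quadBr, (sim_iff m Γ).1 (hO.skew _ hR _ _)]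
  · rw [sim_iff]
    exact cls_evol _ F
  · obtain ⟨O', hO'⟩ := exists_app_eq_conj O φ
    exact ⟨O', hO', hφ.isOOperator hO hO', hφ.dualMap_quadBr hO'⟩
  · refine Derivation.ext fun H => ?_
    rw [Derivation.commutator_apply]
    exact L.hat_commutator X Y H
  · exact ⟨_, isTilde_neg_coad_vder L H, fun K hK => hK.unique L (isTilde_neg_coad_vder L H)⟩
  · intro H F K J hK hJ X
    rw [sim_iff, hK.unique L (isTilde_neg_coad_vder L H),
      hJ.unique L (isTilde_neg_coad_vder L F), L.dualBrac_neg_neg]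
    exact hO.cls_hat_quadBr L X H F
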